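/- Let $\Sigma\subset\mathbb R$ be a compact set with at most countably many connected components whose logarithmic capacity is strictly greater than $1$. Here the capacity of $\Sigma$ is $$c_\Sigma=\sup_\nu e^{-I(\nu)},\qquad I(\nu)=\int\!\!\int -\log|z-w|\,d\nu(w)\,d\nu(z)\in\mathbb R\cup\{+\infty\},$$ the supremum being over all Borel probability measures $\nu$ with support contained in $\Sigma$. Let $\mu$ be a Borel probability measure with support contained in $\Sigma$ such that $$\int_\Sigma \log|Q(x)|\,d\mu(x)\ \ge\ 0\qquad\text{for every nonzero } Q\in\mathbb Z[x],$$ where $\log 0=-\infty$ and the integral takes values in $[-\infty,\infty)$. Then there are a sequence $\mu_1,\mu_2,\dots$ of Borel probability measures on $\mathbb R$ and a sequence $\Sigma_1,\Sigma_2,\dots$ of closed subsets of $\Sigma$ such that: (0) each $\mu_k$ is Hölder, that is, there are $A,\eta>0$ (depending on $k$) with $\mu_k([x,y])\le A\,|y-x|^{\eta}$ for every bounded closed interval $[x,y]\subset\mathbb R$; (1) for every $k\ge 1$, $\Sigma_k$ is a compact finite union of intervals, that is, $\Sigma_k$ is compact, nonempty, has finitely many connected components and has no isolated points, and the support of $\mu_k$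 is contained in $\Sigma_k$; (2) for every $k\ge1$ and every nonzero $Q\in\mathbb Z[x]$, $\int_{\Sigma_k}\log|Q|\,d\mu_k\ge 0$; (3) $\mu_k$ converges weak* to $\mu$, that is, $\int_\Sigma f\,d\mu_k\to\int_\Sigma f\,d\mu$ for every continuous $f:\Sigma\to\mathbb R$. -/

import Mathlib

open MeasureTheory Filter Topology Polynomial

noncomputable section

/-- The integral of an extended-real-valued function, as the integral of its positive part minus
the integral of its negative part. It agrees with the usual integral on integrable functions and
equals `⊥` (resp. `⊤`) when exactly the negative (resp. positive) part has infinite integral. -/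
def extIntegral {X : Type*} [MeasurableSpace X] (μ : Measure X) (f : X → EReal) : EReal :=
  ((∫⁻ x, (f x).toENNReal ∂μ : ENNReal) : EReal) - ((∫⁻ x, (-f x).toENNReal ∂μ : ENNReal) : EReal)

/-- The logarithmic potential `U^μ(z) = ∫ -log |z - w| dμ(w)`, where `-log 0 = +∞`. -/
def logPotential {X : Type*} [PseudoEMetricSpace X] [MeasurableSpace X]
    (μ : Measure X) (z : X) : EReal :=
  extIntegral μ fun w => -ENNReal.log (edist z w)

/-- The logarithmic energy `I(μ) = ∫ U^μ(z) dμ(z)`. -/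
def logEnergy {X : Type*} [PseudoEMetricSpace X] [MeasurableSpace X] (μ : Measure X) : EReal :=
  extIntegral μ (logPotential μ)

/-- The logarithmic capacity: the supremum of `exp (-I(μ))` over all probability measures `μ`
with support contained in `S`. -/
def logCapacity {X : Type*} [PseudoEMetricSpace X] [MeasurableSpace X] (S : Set X) : ENNReal :=
  ⨆ (μ : Measure X) (_ : IsProbabilityMeasure μ) (_ : μ.support ⊆ S), EReal.exp (-logEnergy μ)

/-- The integral `∫_S log |Q(x)| dμ(x)`, where `log 0 = -∞`. -/
def logPolyIntegral (μ : Measure ℝ) (S : Set ℝ) (Q : ℤ[X]) : EReal :=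
  extIntegral (μ.restrict S) fun x => ENNReal.log ‖aeval x Q‖ₑ

/-- A Hölder measure on the real line. -/
def IsHolderMeasure (μ : Measure ℝ) : Prop :=
  ∃ A : ℝ, ∃ η : ℝ, 0 < A ∧ 0 < η ∧
    ∀ x y : ℝ, x ≤ y → μ (Set.Icc x y) ≤ ENNReal.ofReal (A * |y - x| ^ η)

/-- A nonempty compact set of reals with finitely many connected components and without
isolated points. -/
def IsCompactFiniteUnionOfIntervals (S : Set ℝ) : Prop :=
  IsCompact S ∧ S.Nonempty ∧ Finite (ConnectedComponents S) ∧ Preperfect S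

/-- Weak* convergence of measures with support contained in `S`: convergence of the integrals over
`S` of every real-valued function that is continuous on `S`. -/
def WeakStarTendsto (S : Set ℝ) (μs : ℕ → Measure ℝ) (μ : Measure ℝ) : Prop :=
  ∀ f : ℝ → ℝ, ContinuousOn f S →
    Tendsto (fun k => ∫ x in S, f x ∂(μs k)) atTop (𝓝 (∫ x in S, f x ∂μ))

end

noncomputable section

/-! ### Extended-real integrals and Bochner integrals -/

theorem extIntegral_eq_coe_integral {X : Type*} [MeasurableSpace X] {μ : Measure X} {f : X → ℝ}
    {g : X → EReal} (hf : Integrable f μ) (hg : ∀ᵐ x ∂μ, g x = (f x : EReal)) :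
    extIntegral μ g = ((∫ x, f x ∂μ : ℝ) : EReal) := by
  have h1 : ∫⁻ x, (g x).toENNReal ∂μ = ∫⁻ x, ENNReal.ofReal (f x) ∂μ :=
    lintegral_congr_ae (hg.mono fun x hx => by simp [hx])
  have h2 : ∫⁻ x, (-g x).toENNReal ∂μ = ∫⁻ x, ENNReal.ofReal (-f x) ∂μ :=
    lintegral_congr_ae (hg.mono fun x hx => by
      simp only [hx, ← EReal.coe_neg, EReal.real_coe_toENNReal])
  have hP : ∫⁻ x, ENNReal.ofReal (f x) ∂μ ≠ ⊤ := hf.lintegral_lt_top.ne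
  have hN : ∫⁻ x, ENNReal.ofReal (-f x) ∂μ ≠ ⊤ := hf.neg.lintegral_lt_top.ne
  rw [extIntegral, h1, h2, integral_eq_lintegral_pos_part_sub_lintegral_neg_part hf, EReal.coe_sub,
    EReal.coe_ennreal_toReal hP, EReal.coe_ennreal_toReal hN]

theorem EReal.toENNReal_add_coe_add_toENNReal_neg {c : ℝ} (hc : 0 ≤ c) {y : EReal}
    (hy : -(c : EReal) ≤ y) :
    (y + c).toENNReal + (-y).toENNReal = y.toENNReal + ENNReal.ofReal c := by
  induction y with
  | bot => simp at hy
  | top => simp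
  | coe r =>
    have hr : -c ≤ r := by exact_mod_cast hy
    rw [← EReal.coe_add, ← EReal.coe_neg]
    simp only [EReal.real_coe_toENNReal]
    rcases le_total 0 r with h | h
    · rw [ENNReal.ofReal_of_nonpos (p := -r) (by linarith), ENNReal.ofReal_add h hc, add_zero]
    · rw [ENNReal.ofReal_of_nonpos h, ← ENNReal.ofReal_add (by linarith) (by linarith), zero_add]
      congr 1
      ring

/-- The lower integral is superadditive for arbitrary functions, so one inequality survives without
measurability of `f`. It can thus be applied to `logPotential ν` directly. -/
theorem lintegral_le_extIntegral_add {X : Type*} [MeasurableSpace X] (μ : Measure X)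
    [IsProbabilityMeasure μ] {c : ℝ} (hc : 0 ≤ c) {f : X → EReal}
    (hf : ∀ᵐ x ∂μ, -(c : EReal) ≤ f x) :
    ((∫⁻ x, (f x + c).toENNReal ∂μ : ENNReal) : EReal) ≤ extIntegral μ f + c := by
  have key : ∫⁻ x, (f x + c).toENNReal ∂μ + ∫⁻ x, (-f x).toENNReal ∂μ
      ≤ ∫⁻ x, (f x).toENNReal ∂μ + ENNReal.ofReal c := by
    refine (le_lintegral_add _ _).trans ?_
    rw [lintegral_congr_ae (hf.mono fun x hx => EReal.toENNReal_add_coe_add_toENNReal_neg hc hx),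
      lintegral_add_right _ measurable_const]
    simp
  have hN : ∫⁻ x, (-f x).toENNReal ∂μ ≠ ⊤ := by
    have : ∫⁻ x, (-f x).toENNReal ∂μ ≤ ∫⁻ _, ENNReal.ofReal c ∂μ := by
      refine lintegral_mono_ae (hf.mono fun x hx => ?_)
      rw [← EReal.real_coe_toENNReal]
      exact EReal.toENNReal_le_toENNReal (EReal.neg_le_of_neg_le hx)
    refine (this.trans_lt ?_).ne
    simp
  rw [extIntegral]
  generalize ∫⁻ x, (f x + c).toENNReal ∂μ = T at *
  generalize ∫⁻ x, (-f x).toENNReal ∂μ = N at *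
  generalize ∫⁻ x, (f x).toENNReal ∂μ = P at *
  lift N to NNReal using hN
  induction P with
  | top =>
    have : ((⊤ : ENNReal) : EReal) - ((N : ENNReal) : EReal) + c = ⊤ := by
      rw [EReal.coe_ennreal_top]
      have : (((N : NNReal) : ENNReal) : EReal) = ((N : ℝ) : EReal) := rfl
      rw [this, EReal.top_sub_coe, EReal.top_add_coe]
    rw [this]
    exact le_top
  | coe P =>
    have hT : T ≠ ⊤ := by
      rintro rfl
      simp at key
    lift T to NNReal using hT
    have h1 : (T : ℝ) + N ≤ P + c := by
      have := ENNReal.toReal_mono (by simp) key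
      rw [ENNReal.toReal_add (by simp) (by simp), ENNReal.toReal_add (by simp) (by simp),
        ENNReal.toReal_ofReal hc] at this
      simpa using this
    change ((T : ℝ) : EReal) ≤ ((P : ℝ) : EReal) - ((N : ℝ) : EReal) + (c : EReal)
    rw [← EReal.coe_sub, ← EReal.coe_add, EReal.coe_le_coe_iff]
    linarith

theorem measure_compl_eq_zero_of_support_subset {μ : Measure ℝ} {S : Set ℝ} (h : μ.support ⊆ S) :
    μ Sᶜ = 0 :=
  measure_mono_null (Set.compl_subset_compl.2 h) Measure.measure_compl_support

theorem log_enorm_eq_coe {x : ℝ} (hx : x ≠ 0) :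
    ENNReal.log ‖x‖ₑ = ((Real.log |x| : ℝ) : EReal) := by
  rw [← ofReal_norm, ENNReal.log_ofReal_of_pos (norm_pos_iff.2 hx), Real.norm_eq_abs]

/-- A measure of negative logarithmic energy on a bounded set has a log-integrable distance
function. -/
theorem integrable_log_abs_sub_of_logEnergy_neg {ν : Measure ℝ} [IsProbabilityMeasure ν]
    {S : Set ℝ} (hν : ν Sᶜ = 0) {D : ℝ} (hD : 1 ≤ D) (hS : ∀ x ∈ S, ∀ y ∈ S, |x - y| ≤ D)
    (hI : logEnergy ν < 0) :
    Integrable (fun p : ℝ × ℝ => Real.log |p.1 - p.2|) (ν.prod ν) ∧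
      0 < ∫ p : ℝ × ℝ, Real.log |p.1 - p.2| ∂(ν.prod ν) ∧ ∀ᵐ p ∂(ν.prod ν), p.1 ≠ p.2 := by
  set c := Real.log D with hc
  have hc0 : 0 ≤ c := Real.log_nonneg hD
  have hSae : ∀ᵐ x ∂ν, x ∈ S := by rwa [ae_iff]
  have hlogD : ENNReal.log (ENNReal.ofReal D) = (c : EReal) :=
    ENNReal.log_ofReal_of_pos (by linarith)
  have hlow : ∀ x ∈ S, ∀ y ∈ S, -(c : EReal) ≤ -ENNReal.log (edist x y) := by
    intro x hx y hy
    rw [EReal.neg_le_neg_iff, ← hlogD]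
    refine ENNReal.log_le_log ?_
    rw [edist_dist]
    exact ENNReal.ofReal_le_ofReal (hS x hx y hy)
  -- Adding `c = log D` makes the kernel nonnegative on `S × S`. Tonelli then applies, and negative
  -- energy becomes `∫ g < c`. Since `g = ⊤` on the diagonal, finiteness also shows that the
  -- diagonal is null.
  let g : ℝ × ℝ → ENNReal := fun p => (-ENNReal.log (edist p.1 p.2) + c).toENNReal
  have hgm : Measurable g := by
    refine Measurable.ereal_toENNReal ?_
    have h1 : Measurable fun p : ℝ × ℝ => -ENNReal.log (edist p.1 p.2) :=
      (measurable_fst.edist measurable_snd).ennreal_log.neg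
    have h2 : Continuous fun y : EReal => y + (c : EReal) := by
      refine continuous_iff_continuousAt.2 fun y => ?_
      exact (EReal.continuousAt_add (p := (y, (c : EReal))) (by simp) (by simp)).comp_of_eq
        (f := fun y : EReal => (y, (c : EReal))) (continuousAt_id.prodMk continuousAt_const) rfl
    exact h2.measurable.comp h1
  have h1 : ∀ z ∈ S, ((∫⁻ w, g (z, w) ∂ν : ENNReal) : EReal) ≤ logPotential ν z + c := fun z hz =>
    lintegral_le_extIntegral_add ν hc0 (hSae.mono fun w hw => hlow z hz w hw)
  have h2 : ∀ z ∈ S, -(c : EReal) ≤ logPotential ν z := by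
    intro z hz
    have := (EReal.coe_ennreal_nonneg _).trans (h1 z hz)
    generalize logPotential ν z = y at this
    induction y with
    | bot => simp at this
    | top => simp
    | coe r =>
      have hr : 0 ≤ r + c := by exact_mod_cast this
      have : -c ≤ r := by linarith
      exact_mod_cast this
  have h3 : (((∫⁻ z, ∫⁻ w, g (z, w) ∂ν ∂ν : ENNReal)) : EReal) < c := by
    have ha := lintegral_le_extIntegral_add ν hc0 (hSae.mono fun z hz => h2 z hz)
    have hb : ∫⁻ z, ∫⁻ w, g (z, w) ∂ν ∂ν ≤ ∫⁻ z, (logPotential ν z + c).toENNReal ∂ν := by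
      refine lintegral_mono_ae (hSae.mono fun z hz => ?_)
      rw [← EReal.toENNReal_coe (x := ∫⁻ w, g (z, w) ∂ν)]
      exact EReal.toENNReal_le_toENNReal (h1 z hz)
    refine ((EReal.coe_ennreal_le_coe_ennreal_iff.2 hb).trans ha).trans_lt ?_
    calc extIntegral ν (logPotential ν) + (c : EReal) < 0 + c :=
          EReal.add_lt_add_right_coe hI c
      _ = c := zero_add _
  have h4 : ∫⁻ p, g p ∂(ν.prod ν) < ENNReal.ofReal c := by
    rw [lintegral_prod _ hgm.aemeasurable]
    rw [← EReal.coe_ennreal_lt_coe_ennreal_iff, EReal.coe_ennreal_ofReal, max_eq_left hc0]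
    exact h3
  have hfin : ∀ᵐ p ∂(ν.prod ν), g p < ⊤ := ae_lt_top hgm (h4.trans_le le_top).ne
  have hne : ∀ᵐ p ∂(ν.prod ν), p.1 ≠ p.2 := by
    refine hfin.mono fun p hp h => ?_
    simp [g, h] at hp
  have hSp : ∀ᵐ p ∂(ν.prod ν), p.1 ∈ S ∧ p.2 ∈ S :=
    (Measure.quasiMeasurePreserving_fst.ae hSae).and (Measure.quasiMeasurePreserving_snd.ae hSae)
  have hg : ∀ᵐ p ∂(ν.prod ν), g p = ENNReal.ofReal (c - Real.log |p.1 - p.2|) := by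
    refine hne.mono fun p hp => ?_
    have : edist p.1 p.2 = ‖p.1 - p.2‖ₑ := edist_eq_enorm_sub _ _
    simp only [g]
    rw [this, log_enorm_eq_coe (sub_ne_zero.2 hp), ← EReal.coe_neg, ← EReal.coe_add,
      EReal.real_coe_toENNReal]
    congr 1
    ring
  have hnn : 0 ≤ᵐ[ν.prod ν] fun p => c - Real.log |p.1 - p.2| := by
    filter_upwards [hne, hSp] with p hp hS'
    have := Real.log_le_log (abs_pos.2 (sub_ne_zero.2 hp)) (hS p.1 hS'.1 p.2 hS'.2)
    simp only [Pi.zero_apply]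
    linarith
  have hmeas : Measurable fun p : ℝ × ℝ => c - Real.log |p.1 - p.2| := by
    have : Measurable fun p : ℝ × ℝ => |p.1 - p.2| :=
      (continuous_fst.sub continuous_snd).abs.measurable
    exact (Real.measurable_log.comp this).const_sub c
  rw [lintegral_congr_ae hg] at h4
  have hint : Integrable (fun p : ℝ × ℝ => c - Real.log |p.1 - p.2|) (ν.prod ν) :=
    (lintegral_ofReal_ne_top_iff_integrable hmeas.aestronglyMeasurable hnn).1
      (h4.trans_le le_top).ne
  have hint' : Integrable (fun p : ℝ × ℝ => Real.log |p.1 - p.2|) (ν.prod ν) := by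
    refine ((integrable_const c).sub hint).congr (Eventually.of_forall fun p => ?_)
    simp only [Pi.sub_apply]
    ring
  refine ⟨hint', ?_, hne⟩
  have h5 : ∫ p : ℝ × ℝ, (c - Real.log |p.1 - p.2|) ∂(ν.prod ν) < c := by
    rw [integral_eq_lintegral_of_nonneg_ae hnn hmeas.aestronglyMeasurable]
    exact (ENNReal.lt_ofReal_iff_toReal_lt (h4.trans_le le_top).ne).1 h4
  rw [integral_sub (integrable_const c) hint', integral_const, probReal_univ, one_smul] at h5
  linarith

theorem exists_measure_of_one_lt_logCapacity {S : Set ℝ} (h : 1 < logCapacity S) {D : ℝ}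
    (hD : 1 ≤ D) (hS : ∀ x ∈ S, ∀ y ∈ S, |x - y| ≤ D) :
    ∃ ν : Measure ℝ, IsProbabilityMeasure ν ∧ ν Sᶜ = 0 ∧
      Integrable (fun p : ℝ × ℝ => Real.log |p.1 - p.2|) (ν.prod ν) ∧
      0 < ∫ p : ℝ × ℝ, Real.log |p.1 - p.2| ∂(ν.prod ν) ∧ ∀ᵐ p ∂(ν.prod ν), p.1 ≠ p.2 := by
  simp only [logCapacity, lt_iSup_iff] at h
  obtain ⟨ν, hν, hs, he⟩ := h
  have hc := measure_compl_eq_zero_of_support_subset hs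
  refine ⟨ν, hν, hc, integrable_log_abs_sub_of_logEnergy_neg hc hD hS ?_⟩
  rw [EReal.one_lt_exp_iff] at he
  rwa [← neg_neg (logEnergy ν), EReal.neg_lt_comm, neg_zero]

/-- The condition `0 ≤ ∫ log |Q| dμ` in terms of the Bochner integral. -/
theorem integrable_of_logPolyIntegral_nonneg {μ : Measure ℝ} [IsProbabilityMeasure μ] {S : Set ℝ}
    (hμ : μ Sᶜ = 0) {Q : ℤ[X]} {C : ℝ} (hC : ∀ x ∈ S, |aeval x Q| ≤ C)
    (h : 0 ≤ logPolyIntegral μ S Q) :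
    (∀ᵐ x ∂μ, aeval x Q ≠ 0) ∧ Integrable (fun x => Real.log |aeval x Q|) μ ∧
      0 ≤ ∫ x, Real.log |aeval x Q| ∂μ := by
  have hSae : ∀ᵐ x ∂μ, x ∈ S := by rwa [ae_iff]
  rw [logPolyIntegral, Measure.restrict_eq_self_of_ae_mem hSae] at h
  have hcont : Continuous fun x : ℝ => aeval x Q := Q.continuous_aeval
  have hme : Measurable fun x : ℝ => ENNReal.log ‖aeval x Q‖ₑ :=
    (hcont.measurable.enorm).ennreal_log
  set P := ∫⁻ x, (ENNReal.log ‖aeval x Q‖ₑ).toENNReal ∂μ with hP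
  set N := ∫⁻ x, (-ENNReal.log ‖aeval x Q‖ₑ).toENNReal ∂μ with hN
  have hPtop : P ≠ ⊤ := by
    have : P ≤ ∫⁻ _, ENNReal.ofReal (Real.log (max C 1)) ∂μ := by
      refine lintegral_mono_ae (hSae.mono fun x hx => ?_)
      rw [← EReal.real_coe_toENNReal, ← ENNReal.log_ofReal_of_pos (by positivity)]
      refine EReal.toENNReal_le_toENNReal (ENNReal.log_le_log ?_)
      rw [← ofReal_norm]
      exact ENNReal.ofReal_le_ofReal ((hC x hx).trans (le_max_left _ _))
    exact (this.trans_lt (by simp)).ne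
  -- In `EReal`, subtracting `⊤` always gives `⊥`, so an infinite negative part contradicts `h`
  -- whatever `P` is.
  have hNtop : N ≠ ⊤ := by
    intro hN'
    have h' : 0 ≤ (P : EReal) - (N : EReal) := h
    rw [hN'] at h'
    rw [EReal.coe_ennreal_top, EReal.sub_top] at h'
    simp at h'
  have hne : ∀ᵐ x ∂μ, aeval x Q ≠ 0 := by
    have := ae_lt_top hme.neg.ereal_toENNReal hNtop
    refine this.mono fun x hx h0 => ?_
    simp [h0] at hx
  have heq : ∀ᵐ x ∂μ, ENNReal.log ‖aeval x Q‖ₑ = ((Real.log |aeval x Q| : ℝ) : EReal) :=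
    hne.mono fun x hx => log_enorm_eq_coe hx
  have hm : Measurable fun x : ℝ => Real.log |aeval x Q| :=
    Real.measurable_log.comp hcont.abs.measurable
  have hint : Integrable (fun x => Real.log |aeval x Q|) μ := by
    refine ⟨hm.aestronglyMeasurable, ?_⟩
    rw [hasFiniteIntegral_iff_norm]
    have : ∫⁻ x, ENNReal.ofReal ‖Real.log |aeval x Q|‖ ∂μ = P + N := by
      rw [hP, hN, ← lintegral_add_left hme.ereal_toENNReal]
      refine lintegral_congr_ae (heq.mono fun x hx => ?_)
      simp only [hx, ← EReal.coe_neg, EReal.real_coe_toENNReal]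
      generalize Real.log |aeval x Q| = r
      rcases le_total 0 r with hr | hr
      · rw [ENNReal.ofReal_of_nonpos (p := -r) (by linarith), Real.norm_of_nonneg hr, add_zero]
      · rw [ENNReal.ofReal_of_nonpos hr, Real.norm_of_nonpos hr, zero_add]
    rw [this]
    exact ENNReal.add_lt_top.2 ⟨hPtop.lt_top, hNtop.lt_top⟩
  refine ⟨hne, hint, ?_⟩
  rw [extIntegral_eq_coe_integral hint heq] at h
  exact_mod_cast h

theorem logPolyIntegral_nonneg {μ : Measure ℝ} {S : Set ℝ} (hμ : μ Sᶜ = 0) {Q : ℤ[X]}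
    (hne : ∀ᵐ x ∂μ, aeval x Q ≠ 0) (hint : Integrable (fun x => Real.log |aeval x Q|) μ)
    (h : 0 ≤ ∫ x, Real.log |aeval x Q| ∂μ) : 0 ≤ logPolyIntegral μ S Q := by
  have hSae : ∀ᵐ x ∂μ, x ∈ S := by rwa [ae_iff]
  rw [logPolyIntegral, Measure.restrict_eq_self_of_ae_mem hSae,
    extIntegral_eq_coe_integral hint (hne.mono fun x hx => log_enorm_eq_coe hx)]
  exact_mod_cast h

/-! ### Factorisation over the complex roots -/

/-- The absolute value of a nonzero integer polynomial, factored over its complex roots. -/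
theorem exists_abs_aeval_eq_mul_prod {Q : ℤ[X]} (hQ : Q ≠ 0) :
    ∃ (n : ℕ) (α : Fin n → ℂ) (c : ℝ), 1 ≤ c ∧
      ∀ x : ℝ, |aeval x Q| = c * ∏ i, ‖α i - (x : ℂ)‖ := by
  set P : ℂ[X] := Q.map (Int.castRingHom ℂ) with hP
  have hinj : Function.Injective (Int.castRingHom ℂ) := Int.cast_injective
  have hfac : C P.leadingCoeff * (P.roots.map fun a => X - C a).prod = P :=
    C_leadingCoeff_mul_prod_multiset_X_sub_C
      (IsAlgClosed.splits P).natDegree_eq_card_roots.symm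
  refine ⟨P.roots.toList.length, fun i => P.roots.toList.get i, ‖P.leadingCoeff‖, ?_, ?_⟩
  -- A nonzero integer has absolute value at least one.
  · rw [hP, leadingCoeff_map_of_injective hinj]
    simp only [eq_intCast, Complex.norm_intCast]
    exact_mod_cast Int.one_le_abs (leadingCoeff_ne_zero.2 hQ)
  · intro x
    have h1 : |aeval x Q| = ‖P.eval (x : ℂ)‖ := by
      rw [← Real.norm_eq_abs, ← Complex.norm_real, hP, eval_map]
      congr 1
      have := (aeval_algebraMap_apply ℂ x Q).symm
      exact this
    rw [h1]
    conv_lhs => rw [← hfac]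
    rw [eval_mul, eval_C, norm_mul]
    congr 1
    rw [eval_multiset_prod, Multiset.map_map]
    have : (P.roots.map ((eval (x : ℂ)) ∘ fun a => X - C a)) =
        ((P.roots.toList.map fun a => (x : ℂ) - a : List ℂ) : Multiset ℂ) := by
      rw [← Multiset.map_coe, Multiset.coe_toList]
      simp
    rw [this, Multiset.prod_coe, ← List.ofFn_getElem (xs := P.roots.toList), List.map_ofFn,
      List.prod_ofFn, norm_prod]
    refine Fintype.prod_equiv (finCongr (by simp)) _ _ fun i => ?_
    simp only [Function.comp_apply]
    rw [norm_sub_rev]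
    simp

/-! ### Averages of the logarithmic kernel over intervals -/

/-- The average of `log ‖z - t‖` over `t ∈ [a, a + h]`. -/
def logAvg (a h : ℝ) (z : ℂ) : ℝ := h⁻¹ * ∫ t in a..a + h, Real.log ‖z - (t : ℂ)‖

/-- The average of `log |s - t|` over `s ∈ [a, a + h]` and `t ∈ [b, b + h]`. -/
def logAvg₂ (a b h : ℝ) : ℝ := h⁻¹ * ∫ s in a..a + h, logAvg b h (s : ℂ)

theorem intervalIntegrable_log_norm_sub (z : ℂ) (a b : ℝ) :
    IntervalIntegrable (fun t : ℝ => Real.log ‖z - (t : ℂ)‖) volume a b := by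
  refine MeromorphicOn.intervalIntegrable_log_norm (f := fun t : ℝ => z - (t : ℂ)) fun t _ => ?_
  have h1 : AnalyticAt ℝ (fun t : ℝ => (t : ℂ)) t := Complex.ofRealCLM.analyticAt t
  exact (analyticAt_const.sub h1).meromorphicAt

theorem ae_ofReal_ne (z : ℂ) : ∀ᵐ t : ℝ, (t : ℂ) ≠ z := by
  have : ∀ᵐ t : ℝ, t ≠ z.re := by simp [ae_iff]
  exact this.mono fun t ht h => ht (by simp [← h])

/-- `Real.log 0 = 0` spoils pointwise comparisons at a zero distance, so `H` is only required away
from `z` and `z'`, which excludes a null set of `t`. -/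
theorem logAvg_le_logAvg_add {a h : ℝ} (hh : 0 < h) {z z' : ℂ} {e : ℝ}
    (H : ∀ t ∈ Set.Icc a (a + h), (t : ℂ) ≠ z → (t : ℂ) ≠ z' →
      Real.log ‖z - (t : ℂ)‖ ≤ Real.log ‖z' - (t : ℂ)‖ + e) :
    logAvg a h z ≤ logAvg a h z' + e := by
  have h1 : ∫ t in a..a + h, Real.log ‖z - (t : ℂ)‖ ≤
      ∫ t in a..a + h, (Real.log ‖z' - (t : ℂ)‖ + e) := by
    refine intervalIntegral.integral_mono_ae_restrict (by linarith)
      (intervalIntegrable_log_norm_sub _ _ _)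
      ((intervalIntegrable_log_norm_sub _ _ _).add intervalIntegrable_const) ?_
    filter_upwards [ae_restrict_mem measurableSet_Icc, ae_restrict_of_ae (ae_ofReal_ne z),
      ae_restrict_of_ae (ae_ofReal_ne z')] with t ht h1 h2 using H t ht h1 h2
  rw [intervalIntegral.integral_add (intervalIntegrable_log_norm_sub _ _ _)
    intervalIntegrable_const, intervalIntegral.integral_const] at h1
  simp only [logAvg]
  calc h⁻¹ * ∫ t in a..a + h, Real.log ‖z - (t : ℂ)‖
      ≤ h⁻¹ * ((∫ t in a..a + h, Real.log ‖z' - (t : ℂ)‖) + (a + h - a) • e) := by gcongr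
    _ = _ := by
      rw [smul_eq_mul]
      field_simp
      ring

theorem logAvg_le {a h : ℝ} (hh : 0 < h) {z : ℂ} {c : ℝ}
    (H : ∀ t ∈ Set.Icc a (a + h), (t : ℂ) ≠ z → Real.log ‖z - (t : ℂ)‖ ≤ c) :
    logAvg a h z ≤ c := by
  have h1 : ∫ t in a..a + h, Real.log ‖z - (t : ℂ)‖ ≤ ∫ _ in a..a + h, c := by
    refine intervalIntegral.integral_mono_ae_restrict (by linarith)
      (intervalIntegrable_log_norm_sub _ _ _) intervalIntegrable_const ?_
    filter_upwards [ae_restrict_mem measurableSet_Icc, ae_restrict_of_ae (ae_ofReal_ne z)]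
      with t ht h1 using H t ht h1
  rw [intervalIntegral.integral_const, smul_eq_mul, add_sub_cancel_left] at h1
  rw [logAvg, inv_mul_le_iff₀ hh]
  exact h1

theorem le_logAvg {a h : ℝ} (hh : 0 < h) {z : ℂ} {c : ℝ}
    (H : ∀ t ∈ Set.Icc a (a + h), (t : ℂ) ≠ z → c ≤ Real.log ‖z - (t : ℂ)‖) :
    c ≤ logAvg a h z := by
  have h1 : ∫ _ in a..a + h, c ≤ ∫ t in a..a + h, Real.log ‖z - (t : ℂ)‖ := by
    refine intervalIntegral.integral_mono_ae_restrict (by linarith) intervalIntegrable_const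
      (intervalIntegrable_log_norm_sub _ _ _) ?_
    filter_upwards [ae_restrict_mem measurableSet_Icc, ae_restrict_of_ae (ae_ofReal_ne z)]
      with t ht h1 using H t ht h1
  rw [intervalIntegral.integral_const, smul_eq_mul, add_sub_cancel_left] at h1
  rw [logAvg, le_inv_mul_iff₀ hh]
  exact h1

/-- Projecting to the real axis shortens every distance to a real point. Lower bounds on the plane
thus reduce to the line. -/
theorem logAvg_re_le {a h : ℝ} (hh : 0 < h) (z : ℂ) : logAvg a h (z.re : ℂ) ≤ logAvg a h z := by
  have := logAvg_le_logAvg_add (a := a) hh (z := (z.re : ℂ)) (z' := z) (e := 0) ?_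
  · simpa using this
  · intro t _ h1 _
    rw [add_zero]
    refine Real.log_le_log (norm_pos_iff.2 (sub_ne_zero.2 h1.symm)) ?_
    rw [← Complex.ofReal_sub, Complex.norm_real, Real.norm_eq_abs]
    simpa using Complex.abs_re_le_norm (z - t)

theorem logAvg_ofReal {a h : ℝ} (x : ℝ) : logAvg a h (x : ℂ) =
    h⁻¹ * ((x - a) * Real.log (x - a) - (x - a - h) * Real.log (x - a - h) - h) := by
  rw [logAvg]
  congr 1
  have h1 : ∀ t : ℝ, Real.log ‖(x : ℂ) - (t : ℂ)‖ = Real.log (x - t) := fun t => by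
    rw [← Complex.ofReal_sub, Complex.norm_real, Real.norm_eq_abs, Real.log_abs]
  simp only [h1]
  rw [intervalIntegral.integral_comp_sub_left (fun v => Real.log v) x, integral_log]
  ring_nf

theorem continuous_logAvg_ofReal (a h : ℝ) : Continuous fun x : ℝ => logAvg a h (x : ℂ) := by
  simp only [logAvg_ofReal]
  have h1 : Continuous fun x : ℝ => (x - a) * Real.log (x - a) :=
    Real.continuous_mul_log.comp (continuous_id.sub continuous_const)
  have h2 : Continuous fun x : ℝ => (x - a - h) * Real.log (x - a - h) :=
    Real.continuous_mul_log.comp ((continuous_id.sub continuous_const).sub continuous_const)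
  exact continuous_const.mul ((h1.sub h2).sub continuous_const)

/-- The cases `u ≤ 0` and `h ≤ u` are exchanged by `u ↦ h - u` and follow from monotonicity of the
logarithm. For `0 ≤ u ≤ h`, add the tangent-line bounds of `v log v` at `v = h`, taken at `u` and at
`h - u`. -/
theorem Real.mul_log_sub_sub_mul_log_ge {h : ℝ} (hh : 0 < h) (u : ℝ) :
    h * Real.log h - h ≤ u * Real.log u - (u - h) * Real.log (u - h) := by
  have key : ∀ v, 0 ≤ v → h * Real.log h - h ≤ (v + h) * Real.log (v + h) - v * Real.log v := by
    intro v hv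
    have h1 : h * Real.log h ≤ h * Real.log (v + h) :=
      mul_le_mul_of_nonneg_left (Real.log_le_log hh (by linarith)) hh.le
    have h2 : v * Real.log v ≤ v * Real.log (v + h) := by
      rcases hv.eq_or_lt with rfl | hv
      · simp
      · exact mul_le_mul_of_nonneg_left (Real.log_le_log hv (by linarith)) hv.le
    linarith
  have key2 : ∀ v, 0 ≤ v → v * Real.log h - h + v ≤ v * Real.log v := by
    intro v hv
    rcases hv.eq_or_lt with rfl | hv
    · simp [hh.le]
    · have := Real.one_sub_inv_le_log_of_pos (div_pos hv hh)
      rw [Real.log_div hv.ne' hh.ne', inv_div] at this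
      have := mul_le_mul_of_nonneg_left this hv.le
      have e : v * (1 - h / v) = v - h := by field_simp
      nlinarith
  rcases le_total u 0 with hu | hu
  · have := key (-u) (by linarith)
    have e1 : Real.log (-u + h) = Real.log (u - h) := by rw [← Real.log_neg_eq_log]; ring_nf
    rw [e1, Real.log_neg_eq_log] at this
    linarith
  · rcases le_total h u with hu' | hu'
    · have := key (u - h) (by linarith)
      simpa using this
    · have h1 := key2 u hu
      have h2 := key2 (h - u) (by linarith)
      have e1 : Real.log (h - u) = Real.log (u - h) := by rw [← Real.log_neg_eq_log]; ring_nf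
      rw [e1] at h2
      linarith

theorem log_sub_two_le_logAvg {h : ℝ} (hh : 0 < h) (a : ℝ) (z : ℂ) :
    Real.log h - 2 ≤ logAvg a h z := by
  refine le_trans ?_ (logAvg_re_le hh z)
  rw [logAvg_ofReal, le_inv_mul_iff₀ hh]
  have := Real.mul_log_sub_sub_mul_log_ge hh (z.re - a)
  linarith

theorem intervalIntegrable_logAvg (b h c d : ℝ) :
    IntervalIntegrable (fun s : ℝ => logAvg b h (s : ℂ)) volume c d :=
  (continuous_logAvg_ofReal b h).intervalIntegrable _ _

theorem logAvg₂_le {a b h : ℝ} (hh : 0 < h) {c : ℝ}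
    (H : ∀ s ∈ Set.Icc a (a + h), logAvg b h (s : ℂ) ≤ c) : logAvg₂ a b h ≤ c := by
  have h1 : ∫ s in a..a + h, logAvg b h (s : ℂ) ≤ ∫ _ in a..a + h, c :=
    intervalIntegral.integral_mono_on (by linarith) (intervalIntegrable_logAvg _ _ _ _)
      intervalIntegrable_const H
  rw [intervalIntegral.integral_const, smul_eq_mul, add_sub_cancel_left] at h1
  rw [logAvg₂, inv_mul_le_iff₀ hh]
  exact h1

theorem le_logAvg₂ {a b h : ℝ} (hh : 0 < h) {c : ℝ}
    (H : ∀ s ∈ Set.Icc a (a + h), c ≤ logAvg b h (s : ℂ)) : c ≤ logAvg₂ a b h := by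
  have h1 : ∫ _ in a..a + h, c ≤ ∫ s in a..a + h, logAvg b h (s : ℂ) :=
    intervalIntegral.integral_mono_on (by linarith) intervalIntegrable_const
      (intervalIntegrable_logAvg _ _ _ _) H
  rw [intervalIntegral.integral_const, smul_eq_mul, add_sub_cancel_left] at h1
  rw [logAvg₂, le_inv_mul_iff₀ hh]
  exact h1

theorem logAvg_eq_integral_unit {h : ℝ} (hh : 0 < h) (a : ℝ) (z : ℂ) :
    logAvg a h z = ∫ v in (0 : ℝ)..1, Real.log ‖z - ((a + h * v : ℝ) : ℂ)‖ := by
  rw [intervalIntegral.integral_comp_add_mul (fun t : ℝ => Real.log ‖z - (t : ℂ)‖) hh.ne' a]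
  simp [logAvg]

theorem logAvg₂_eq_integral_unit {h : ℝ} (hh : 0 < h) (a b : ℝ) :
    logAvg₂ a b h = ∫ u in (0 : ℝ)..1, ∫ v in (0 : ℝ)..1,
      Real.log |(a + h * u) - (b + h * v)| := by
  have : ∀ u : ℝ, ∫ v in (0 : ℝ)..1, Real.log |(a + h * u) - (b + h * v)| =
      logAvg b h ((a + h * u : ℝ) : ℂ) := fun u => by
    rw [logAvg_eq_integral_unit hh]
    refine intervalIntegral.integral_congr fun v _ => ?_
    rw [← Complex.ofReal_sub, Complex.norm_real, Real.norm_eq_abs]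
  simp only [this]
  rw [intervalIntegral.integral_comp_add_mul (fun s : ℝ => logAvg b h (s : ℂ)) hh.ne' a]
  simp [logAvg₂]

/-- Reflecting both unit variables by `u ↦ 1 - u` and `v ↦ 1 - v` exchanges the two base points, so
the order of integration never has to be swapped. -/
theorem logAvg₂_comm {h : ℝ} (hh : 0 < h) (a b : ℝ) : logAvg₂ a b h = logAvg₂ b a h := by
  rw [logAvg₂_eq_integral_unit hh, logAvg₂_eq_integral_unit hh]
  have h1 := intervalIntegral.integral_comp_sub_left (a := 0) (b := 1)
    (fun u : ℝ => ∫ v in (0 : ℝ)..1, Real.log |(a + h * u) - (b + h * v)|) 1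
  rw [sub_self, sub_zero] at h1
  rw [← h1]
  refine intervalIntegral.integral_congr fun u _ => ?_
  have h2 := intervalIntegral.integral_comp_sub_left (a := 0) (b := 1)
    (fun v : ℝ => Real.log |(a + h * (1 - u)) - (b + h * v)|) 1
  rw [sub_self, sub_zero] at h2
  rw [← h2]
  refine intervalIntegral.integral_congr fun v _ => ?_
  rw [abs_sub_comm]
  congr 2
  ring

theorem norm_ofReal_sub_ofReal (s t : ℝ) : ‖(s : ℂ) - (t : ℂ)‖ = |s - t| := by
  rw [← Complex.ofReal_sub, Complex.norm_real, Real.norm_eq_abs]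

theorem logAvg₂_le_log {a b h : ℝ} (hh : 0 < h) {x y : ℝ} (hx : x ∈ Set.Icc a (a + h))
    (hy : y ∈ Set.Icc b (b + h)) : logAvg₂ a b h ≤ Real.log (|x - y| + 2 * h) := by
  refine logAvg₂_le hh fun s hs => logAvg_le hh fun t ht hts => ?_
  rw [norm_ofReal_sub_ofReal]
  refine Real.log_le_log (abs_pos.2 (sub_ne_zero.2 fun h => hts (by rw [h]))) ?_
  have h1 : |s - t| ≤ |x - y| + |(s - x) + (y - t)| := by
    calc |s - t| = |(x - y) + ((s - x) + (y - t))| := by ring_nf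
      _ ≤ _ := abs_add_le _ _
  have h2 : |(s - x) + (y - t)| ≤ 2 * h := by
    rw [abs_le]
    constructor <;> linarith [hs.1, hs.2, ht.1, ht.2, hx.1, hx.2, hy.1, hy.2]
  linarith

theorem log_le_logAvg₂ {a b h : ℝ} (hh : 0 < h) {x y : ℝ} (hx : x ∈ Set.Icc a (a + h))
    (hy : y ∈ Set.Icc b (b + h)) (hxy : 2 * h < |x - y|) :
    Real.log (|x - y| - 2 * h) ≤ logAvg₂ a b h := by
  refine le_logAvg₂ hh fun s hs => le_logAvg hh fun t ht hts => ?_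
  rw [norm_ofReal_sub_ofReal]
  refine Real.log_le_log (by linarith) ?_
  have h1 : |x - y| ≤ |s - t| + |(x - s) + (t - y)| := by
    calc |x - y| = |(s - t) + ((x - s) + (t - y))| := by ring_nf
      _ ≤ _ := abs_add_le _ _
  have h2 : |(x - s) + (t - y)| ≤ 2 * h := by
    rw [abs_le]
    constructor <;> linarith [hs.1, hs.2, ht.1, ht.2, hx.1, hx.2, hy.1, hy.2]
  linarith

/-- The loss does not depend on `h`, as needed for dominated convergence in the mesh. If `|x - y| ≥
4 h`, the perturbation `2 h` costs at most a factor `4`; otherwise the universal bound `log h - 2`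
suffices. The `5` is `2` plus the bound `log 4 ≤ 3`. -/
theorem log_sub_le_logAvg₂ {a b h : ℝ} (hh : 0 < h) {x y : ℝ} (hx : x ∈ Set.Icc a (a + h))
    (hy : y ∈ Set.Icc b (b + h)) (hxy : x ≠ y) :
    Real.log |x - y| - 5 ≤ logAvg₂ a b h := by
  have hpos : 0 < |x - y| := abs_pos.2 (sub_ne_zero.2 hxy)
  have h2 : Real.log 4 ≤ 3 := by
    have := Real.log_le_sub_one_of_pos (show (0 : ℝ) < 4 by norm_num)
    linarith
  rcases le_or_gt (4 * h) |x - y| with hfar | hnear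
  · refine le_trans ?_ (log_le_logAvg₂ hh hx hy (by linarith))
    have : Real.log (|x - y| / 4) ≤ Real.log (|x - y| - 2 * h) :=
      Real.log_le_log (by linarith) (by linarith)
    rw [Real.log_div hpos.ne' (by norm_num)] at this
    linarith
  · have h1 : Real.log |x - y| ≤ Real.log 4 + Real.log h := by
      rw [← Real.log_mul (by norm_num) hh.ne']
      exact Real.log_le_log hpos hnear.le
    have h3 : Real.log h - 2 ≤ logAvg₂ a b h :=
      le_logAvg₂ hh fun s _ => log_sub_two_le_logAvg hh b _
    linarith

/-- The price, uniform in the root `z`, of spreading a point mass over its cell. If `z` is at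
distance at least `K h`, distances shrink by a factor at least `1 - 1 / K`, costing at most `2 / K`;
if it is nearer, compare `log (K h)` with `log h - 2`. -/
theorem log_norm_sub_le_logAvg_add {a h K : ℝ} (hh : 0 < h) (hK : 2 ≤ K) {z : ℂ} {x : ℝ}
    (hx : x ∈ Set.Icc a (a + h)) (hzx : z ≠ x) :
    Real.log ‖z - x‖ ≤ logAvg a h z + 2 / K +
      (if ‖z - x‖ < K * h then Real.log K + 2 else 0) := by
  have hpos : 0 < ‖z - x‖ := norm_pos_iff.2 (sub_ne_zero.2 hzx)
  have hK0 : 0 < K := by linarith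
  split_ifs with hn
  · have h1 : Real.log ‖z - x‖ ≤ Real.log K + Real.log h := by
      rw [← Real.log_mul hK0.ne' hh.ne']
      exact Real.log_le_log hpos hn.le
    have := log_sub_two_le_logAvg hh a z
    have : 0 < 2 / K := by positivity
    linarith
  · push Not at hn
    have hinv : K⁻¹ ≤ 1 / 2 := by
      rw [inv_le_comm₀ hK0 (by norm_num)]
      simpa using hK
    have hinv0 : 0 < K⁻¹ := inv_pos.2 hK0
    have hh' : h ≤ ‖z - x‖ * K⁻¹ := by
      rw [← div_eq_mul_inv, le_div_iff₀ hK0]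
      linarith
    have h1 : Real.log (‖z - x‖ * (1 - K⁻¹)) ≤ logAvg a h z := by
      refine le_logAvg hh fun t ht _ => Real.log_le_log (mul_pos hpos (by linarith)) ?_
      have h2 : ‖z - x‖ ≤ ‖z - t‖ + ‖(t : ℂ) - x‖ := norm_sub_le_norm_sub_add_norm_sub _ _ _
      have h3 : ‖(t : ℂ) - x‖ ≤ h := by
        rw [norm_ofReal_sub_ofReal, abs_le]
        constructor <;> linarith [ht.1, ht.2, hx.1, hx.2]
      nlinarith
    rw [Real.log_mul hpos.ne' (by linarith)] at h1
    have h4 := Real.one_sub_inv_le_log_of_pos (show 0 < 1 - K⁻¹ by linarith)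
    have h5 : (1 - K⁻¹)⁻¹ ≤ 1 + 2 * K⁻¹ := by
      rw [inv_le_iff_one_le_mul₀ (by linarith)]
      nlinarith
    rw [div_eq_mul_inv]
    linarith

/-! ### The countable boundary and grid cells inside the set -/

/-- A component is a bounded interval, and every point of it other than its infimum and supremum is
interior to `S`. Each component therefore contributes at most two exceptional points. -/
theorem countable_diff_interior {S : Set ℝ} (hS : IsCompact S)
    (hcomp : Countable (ConnectedComponents S)) : (S \ interior S).Countable := by
  let A : ConnectedComponents S → Set ℝ := fun c =>
    Subtype.val '' ((ConnectedComponents.mk : S → ConnectedComponents S) ⁻¹' {c})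
  have hAS : ∀ c, A c ⊆ S := by
    rintro c _ ⟨x, -, rfl⟩
    exact x.2
  have hA : ∀ c, (A c).OrdConnected := by
    intro c
    obtain ⟨x, rfl⟩ := ConnectedComponents.surjective_coe c
    have : IsPreconnected (A (ConnectedComponents.mk x)) := by
      simp only [A]
      rw [connectedComponents_preimage_singleton]
      exact isPreconnected_connectedComponent.image _ continuous_subtype_val.continuousOn
    exact this.ordConnected
  have hsub : S \ interior S ⊆ ⋃ c, ({sInf (A c), sSup (A c)} : Set ℝ) := by
    rintro x ⟨hx, hxi⟩
    refine Set.mem_iUnion.2 ⟨ConnectedComponents.mk ⟨x, hx⟩, ?_⟩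
    set B := A (ConnectedComponents.mk ⟨x, hx⟩) with hB
    have hxB : x ∈ B := ⟨⟨x, hx⟩, rfl, rfl⟩
    have hbb : BddBelow B := hS.bddBelow.mono (hAS _)
    have hba : BddAbove B := hS.bddAbove.mono (hAS _)
    by_contra hne
    simp only [Set.mem_insert_iff, Set.mem_singleton_iff, not_or] at hne
    obtain ⟨y, hy, hyx⟩ := exists_lt_of_csInf_lt ⟨x, hxB⟩
      (lt_of_le_of_ne (csInf_le hbb hxB) (Ne.symm hne.1))
    obtain ⟨z, hz, hxz⟩ := exists_lt_of_lt_csSup ⟨x, hxB⟩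
      (lt_of_le_of_ne (le_csSup hba hxB) hne.2)
    refine hxi (mem_interior.2 ⟨Set.Ioo y z, ?_, isOpen_Ioo, hyx, hxz⟩)
    exact Set.Ioo_subset_Icc_self.trans (((hA _).out hy hz).trans (hAS _))
  exact (Set.countable_iUnion fun c => ((Set.countable_singleton _).insert _)).mono hsub

/-- The indices `k` of the grid cells `[k h, k h + h]` contained in `S`. -/
def gridIndices (S : Set ℝ) (h : ℝ) : Set ℤ := {k | Set.Icc (k * h) (k * h + h) ⊆ S}

/-- The half-open grid cell of index `k` and mesh `h`. -/
def gridCell (h : ℝ) (k : ℤ) : Set ℝ := Set.Ico (k * h) (k * h + h)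

theorem mem_gridCell_iff {h : ℝ} (hh : 0 < h) {k : ℤ} {x : ℝ} :
    x ∈ gridCell h k ↔ ⌊x / h⌋ = k := by
  rw [gridCell, Set.mem_Ico, Int.floor_eq_iff, le_div_iff₀ hh, div_lt_iff₀ hh, add_mul, one_mul]

theorem measurableSet_gridCell (h : ℝ) (k : ℤ) : MeasurableSet (gridCell h k) := measurableSet_Ico

theorem gridCell_subset_Icc (h : ℝ) (k : ℤ) :
    gridCell h k ⊆ Set.Icc (k * h) (k * h + h) := Set.Ico_subset_Icc_self

theorem disjoint_gridCell {h : ℝ} (hh : 0 < h) {k l : ℤ} (hkl : k ≠ l) :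
    Disjoint (gridCell h k) (gridCell h l) :=
  Set.disjoint_left.2 fun _ hk hl =>
    hkl (((mem_gridCell_iff hh).1 hk).symm.trans ((mem_gridCell_iff hh).1 hl))

theorem finite_gridIndices {S : Set ℝ} (hS : IsCompact S) {h : ℝ} (hh : 0 < h) :
    (gridIndices S h).Finite := by
  obtain ⟨R, hR⟩ := hS.isBounded.subset_closedBall 0
  refine (Set.finite_Icc ⌊-R / h⌋ ⌊R / h⌋).subset fun k hk => ?_
  have h1 : (k * h : ℝ) ∈ S := hk ⟨le_rfl, by linarith⟩
  have h2 := hR h1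
  rw [Real.closedBall_eq_Icc, zero_sub, zero_add] at h2
  constructor
  · have : -R / h ≤ k := by rw [div_le_iff₀ hh]; exact h2.1
    exact_mod_cast (Int.floor_le _).trans this
  · rw [Int.le_floor, le_div_iff₀ hh]
    exact h2.2

theorem eventually_floor_mem_gridIndices {S : Set ℝ} {x : ℝ} (hx : x ∈ interior S) :
    ∀ᶠ h in 𝓝[>] (0 : ℝ), ⌊x / h⌋ ∈ gridIndices S h := by
  obtain ⟨ε, hε, hball⟩ := Metric.isOpen_iff.1 isOpen_interior x hx
  filter_upwards [self_mem_nhdsWithin, mem_nhdsWithin_of_mem_nhds (Iio_mem_nhds hε)] with h hh hhe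
  have hh : 0 < h := hh
  have hx' := (mem_gridCell_iff hh).2 (rfl : ⌊x / h⌋ = ⌊x / h⌋)
  intro t ht
  refine interior_subset (hball ?_)
  rw [Real.ball_eq_Ioo]
  have hhe : h < ε := hhe
  constructor <;> linarith [ht.1, ht.2, hx'.1, hx'.2]

theorem measure_singleton_eq_zero_of_prod_diagonal {ν : Measure ℝ} [IsProbabilityMeasure ν]
    (h : ∀ᵐ p ∂(ν.prod ν), p.1 ≠ p.2) (x : ℝ) : ν {x} = 0 := by
  have h1 : (ν.prod ν) ({x} ×ˢ {x}) = 0 := by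
    refine measure_mono_null ?_ h
    rintro ⟨a, b⟩ ⟨ha, hb⟩
    simp_all
  rw [Measure.prod_prod] at h1
  simpa using h1

/-! ### Discretising the energy -/

/-- The grid discretization of the kernel `log |x - y|`. -/
def gridLog (S : Set ℝ) (h : ℝ) (p : ℝ × ℝ) : ℝ :=
  open Classical in
  if ⌊p.1 / h⌋ ∈ gridIndices S h ∧ ⌊p.2 / h⌋ ∈ gridIndices S h then
    logAvg₂ (⌊p.1 / h⌋ * h) (⌊p.2 / h⌋ * h) h else 0

theorem measurable_gridLog (S : Set ℝ) (h : ℝ) : Measurable (gridLog S h) := by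
  classical
  let f : ℤ × ℤ → ℝ := fun q => if q.1 ∈ gridIndices S h ∧ q.2 ∈ gridIndices S h then
    logAvg₂ (q.1 * h) (q.2 * h) h else 0
  have h1 : Measurable fun p : ℝ × ℝ => (⌊p.1 / h⌋, ⌊p.2 / h⌋) :=
    (Int.measurable_floor.comp (measurable_fst.div_const h)).prodMk
      (Int.measurable_floor.comp (measurable_snd.div_const h))
  exact (measurable_of_countable f).comp h1

theorem tendsto_integral_gridLog {S : Set ℝ} (hcount : (S \ interior S).Countable)
    {ν : Measure ℝ} [IsProbabilityMeasure ν] (hν : ν Sᶜ = 0) {D : ℝ} (hD : 1 ≤ D)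
    (hS : ∀ x ∈ S, ∀ y ∈ S, |x - y| ≤ D)
    (hint : Integrable (fun p : ℝ × ℝ => Real.log |p.1 - p.2|) (ν.prod ν))
    (hdiag : ∀ᵐ p ∂(ν.prod ν), p.1 ≠ p.2) :
    Tendsto (fun h => ∫ p, gridLog S h p ∂(ν.prod ν)) (𝓝[>] 0)
      (𝓝 (∫ p : ℝ × ℝ, Real.log |p.1 - p.2| ∂(ν.prod ν))) := by
  -- A null diagonal excludes atoms, so the countable set `S \ interior S` is null and `ν` is
  -- carried by the interior, where cells eventually fit inside `S`.
  have : NullSingletonClass ν := ⟨measure_singleton_eq_zero_of_prod_diagonal hdiag⟩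
  have hSae : ∀ᵐ x ∂ν, x ∈ interior S := by
    rw [ae_iff]
    refine measure_mono_null (t := Sᶜ ∪ (S \ interior S)) ?_
      (measure_union_null hν (hcount.measure_zero ν))
    intro x hx
    by_cases h : x ∈ S
    · exact Or.inr ⟨h, hx⟩
    · exact Or.inl h
  have hSp : ∀ᵐ p ∂(ν.prod ν), p.1 ∈ interior S ∧ p.2 ∈ interior S :=
    (Measure.quasiMeasurePreserving_fst.ae hSae).and (Measure.quasiMeasurePreserving_snd.ae hSae)
  refine tendsto_integral_filter_of_dominated_convergence
    -- The `5` comes from the lower bound `log_sub_le_logAvg₂`, and `D + 2` from the upper bound `|x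
    -- - y| + 2 h` with `h < 1`.
    (fun p => ‖Real.log |p.1 - p.2|‖ + (5 + Real.log (D + 2)))
    (Eventually.of_forall fun h => (measurable_gridLog S h).aestronglyMeasurable) ?_
    (hint.norm.add (integrable_const _)) ?_
  · filter_upwards [self_mem_nhdsWithin, mem_nhdsWithin_of_mem_nhds (Iio_mem_nhds one_pos)]
      with h hh hh1
    have hh : 0 < h := hh
    have hh1 : h < 1 := hh1
    filter_upwards [hdiag, hSp] with p hp hpS
    have hlogD : 0 ≤ Real.log (D + 2) := Real.log_nonneg (by linarith)
    rw [gridLog]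
    split_ifs with hg
    · have hx := gridCell_subset_Icc _ _ ((mem_gridCell_iff hh).2 (rfl : ⌊p.1 / h⌋ = ⌊p.1 / h⌋))
      have hy := gridCell_subset_Icc _ _ ((mem_gridCell_iff hh).2 (rfl : ⌊p.2 / h⌋ = ⌊p.2 / h⌋))
      have h1 := log_sub_le_logAvg₂ hh hx hy hp
      have h2 := logAvg₂_le_log hh hx hy
      have h3 : Real.log (|p.1 - p.2| + 2 * h) ≤ Real.log (D + 2) := by
        refine Real.log_le_log (by positivity) ?_
        linarith [hS _ (interior_subset hpS.1) _ (interior_subset hpS.2)]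
      rw [Real.norm_eq_abs, Real.norm_eq_abs, abs_le]
      constructor
      · linarith [neg_abs_le (Real.log |p.1 - p.2|)]
      · linarith [abs_nonneg (Real.log |p.1 - p.2|)]
    · rw [norm_zero]
      positivity
  · filter_upwards [hdiag, hSp] with p hp hpS
    have hpos : 0 < |p.1 - p.2| := abs_pos.2 (sub_ne_zero.2 hp)
    have hid : Tendsto (fun h : ℝ => h) (𝓝[>] 0) (𝓝 0) := nhdsWithin_le_nhds
    have hlim : ∀ c : ℝ, Tendsto (fun h : ℝ => Real.log (|p.1 - p.2| + c * h)) (𝓝[>] 0)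
        (𝓝 (Real.log |p.1 - p.2|)) := by
      intro c
      have : Tendsto (fun h : ℝ => |p.1 - p.2| + c * h) (𝓝[>] 0) (𝓝 |p.1 - p.2|) := by
        simpa using (hid.const_mul c).const_add |p.1 - p.2|
      exact (Real.continuousAt_log hpos.ne').tendsto.comp this
    refine tendsto_of_tendsto_of_tendsto_of_le_of_le' (hlim (-2)) (hlim 2) ?_ ?_
    all_goals
      filter_upwards [self_mem_nhdsWithin, eventually_floor_mem_gridIndices hpS.1,
        eventually_floor_mem_gridIndices hpS.2,
        mem_nhdsWithin_of_mem_nhds (Iio_mem_nhds (half_pos hpos))] with h hh h1 h2 h3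
      have hh : 0 < h := hh
      have h3 : h < |p.1 - p.2| / 2 := h3
      rw [gridLog, if_pos ⟨h1, h2⟩]
      have hx := gridCell_subset_Icc _ _ ((mem_gridCell_iff hh).2 (rfl : ⌊p.1 / h⌋ = ⌊p.1 / h⌋))
      have hy := gridCell_subset_Icc _ _ ((mem_gridCell_iff hh).2 (rfl : ⌊p.2 / h⌋ = ⌊p.2 / h⌋))
    · have := log_le_logAvg₂ hh hx hy (by linarith)
      rwa [neg_mul, ← sub_eq_add_neg]
    · exact logAvg₂_le_log hh hx hy

theorem integral_gridLog {S : Set ℝ} {ν : Measure ℝ} [IsProbabilityMeasure ν] {h : ℝ} (hh : 0 < h)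
    {F : Finset ℤ} (hF : ∀ k, k ∈ F ↔ k ∈ gridIndices S h) :
    ∫ p, gridLog S h p ∂(ν.prod ν) = ∑ k ∈ F, ∑ l ∈ F,
      ν.real (gridCell h k) * ν.real (gridCell h l) * logAvg₂ (k * h) (l * h) h := by
  classical
  have h1 : gridLog S h = fun p => ∑ q ∈ F ×ˢ F, (gridCell h q.1 ×ˢ gridCell h q.2).indicator
      (fun _ => logAvg₂ (q.1 * h) (q.2 * h) h) p := by
    funext p
    have hind : ∀ q : ℤ × ℤ, (gridCell h q.1 ×ˢ gridCell h q.2).indicator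
      (fun _ => logAvg₂ (q.1 * h) (q.2 * h) h) p = if (⌊p.1 / h⌋, ⌊p.2 / h⌋) = q then
        logAvg₂ (q.1 * h) (q.2 * h) h else 0 := by
      intro q
      rw [Set.indicator_apply]
      refine if_congr ?_ rfl rfl
      rw [Set.mem_prod, mem_gridCell_iff hh, mem_gridCell_iff hh, Prod.ext_iff]
    simp only [hind]
    rw [Finset.sum_ite_eq, gridLog]
    refine if_congr ?_ rfl rfl
    rw [Finset.mem_product, hF, hF]
  rw [h1, integral_finsetSum]
  · rw [Finset.sum_product]
    refine Finset.sum_congr rfl fun k _ => Finset.sum_congr rfl fun l _ => ?_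
    rw [integral_indicator_const _ ((measurableSet_gridCell _ _).prod (measurableSet_gridCell _ _)),
      measureReal_prod_prod, smul_eq_mul]
  · intro q _
    exact (integrable_const _).indicator
      ((measurableSet_gridCell _ _).prod (measurableSet_gridCell _ _))

theorem sum_measureReal_gridCell_le_one {ν : Measure ℝ} [IsProbabilityMeasure ν] {h : ℝ}
    (hh : 0 < h) (F : Finset ℤ) : ∑ k ∈ F, ν.real (gridCell h k) ≤ 1 := by
  rw [← measureReal_biUnion_finset (fun k _ l _ hkl => disjoint_gridCell hh hkl)
    (fun k _ => measurableSet_gridCell h k)]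
  exact measureReal_le_one

/-- If a measure on `S` has negative logarithmic energy, then so do suitable mixtures of uniform
measures on grid cells contained in `S`, uniformly in the mesh. -/
theorem exists_grid_weights {S : Set ℝ} (hSc : IsCompact S) (hcount : (S \ interior S).Countable)
    {ν : Measure ℝ} [IsProbabilityMeasure ν] (hν : ν Sᶜ = 0) {D : ℝ} (hD : 1 ≤ D)
    (hS : ∀ x ∈ S, ∀ y ∈ S, |x - y| ≤ D)
    (hint : Integrable (fun p : ℝ × ℝ => Real.log |p.1 - p.2|) (ν.prod ν))
    (hpos : 0 < ∫ p : ℝ × ℝ, Real.log |p.1 - p.2| ∂(ν.prod ν))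
    (hdiag : ∀ᵐ p ∂(ν.prod ν), p.1 ≠ p.2) :
    ∃ E : ℝ, 0 < E ∧ ∀ᶠ h in 𝓝[>] (0 : ℝ), ∃ (F : Finset ℤ) (a : ℤ → ℝ),
      (∀ k ∈ F, k ∈ gridIndices S h) ∧ (∀ k ∈ F, 0 ≤ a k) ∧ ∑ k ∈ F, a k = 1 ∧
      E ≤ ∑ k ∈ F, ∑ l ∈ F, a k * a l * logAvg₂ (k * h) (l * h) h := by
  refine ⟨_, half_pos hpos, ?_⟩
  filter_upwards [self_mem_nhdsWithin,
    (tendsto_integral_gridLog hcount hν hD hS hint hdiag).eventually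
      (lt_mem_nhds (half_lt_self hpos))] with h hh hE
  have hh : 0 < h := hh
  set E := (∫ p : ℝ × ℝ, Real.log |p.1 - p.2| ∂(ν.prod ν)) / 2 with hEdef
  have hE0 : 0 < E := half_pos hpos
  set F := (finite_gridIndices hSc hh).toFinset with hF
  have hF' : ∀ k, k ∈ F ↔ k ∈ gridIndices S h := fun k => by simp [hF]
  rw [integral_gridLog hh hF'] at hE
  set m := ∑ k ∈ F, ν.real (gridCell h k) with hm
  have hm1 : m ≤ 1 := sum_measureReal_gridCell_le_one hh F
  have hm0 : 0 < m := by
    refine lt_of_le_of_ne (Finset.sum_nonneg fun _ _ => measureReal_nonneg) fun h0 => ?_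
    have hz := (Finset.sum_eq_zero_iff_of_nonneg fun _ _ => measureReal_nonneg).1 h0.symm
    rw [Finset.sum_eq_zero fun k hk => Finset.sum_eq_zero fun l _ => by rw [hz k hk]; ring] at hE
    linarith
  refine ⟨F, fun k => ν.real (gridCell h k) / m, fun k hk => (hF' k).1 hk,
    fun k _ => div_nonneg measureReal_nonneg hm0.le, ?_, ?_⟩
  · rw [← Finset.sum_div, div_self hm0.ne']
  -- Normalising the weights divides the form by `m ^ 2 ≤ 1`, which can only increase a positive
  -- value.
  · have : ∑ k ∈ F, ∑ l ∈ F, ν.real (gridCell h k) / m * (ν.real (gridCell h l) / m) *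
        logAvg₂ (k * h) (l * h) h = (∑ k ∈ F, ∑ l ∈ F, ν.real (gridCell h k) *
        ν.real (gridCell h l) * logAvg₂ (k * h) (l * h) h) / m ^ 2 := by
      rw [Finset.sum_div]
      refine Finset.sum_congr rfl fun k _ => ?_
      rw [Finset.sum_div]
      refine Finset.sum_congr rfl fun l _ => ?_
      field_simp
    rw [this, le_div_iff₀ (by positivity)]
    have : m ^ 2 ≤ 1 := pow_le_one₀ hm0.le hm1
    nlinarith

/-! ### Energy maximisers and the maximum principle -/

/-- A maximizer of a quadratic form on the standard simplex, with its first-order condition. -/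
theorem exists_maximizer_stdSimplex {ι : Type*} [Fintype ι] (L : ι → ι → ℝ)
    (hL : ∀ i j, L i j = L j i) {a₀ : ι → ℝ} (ha₀ : a₀ ∈ stdSimplex ℝ ι) :
    ∃ a ∈ stdSimplex ℝ ι, (∑ i, ∑ j, a₀ i * a₀ j * L i j ≤ ∑ i, ∑ j, a i * a j * L i j) ∧
      ∀ k, 0 < a k → ∑ i, ∑ j, a i * a j * L i j ≤ ∑ j, a j * L k j := by
  classical
  let G : (ι → ℝ) → ℝ := fun a => ∑ i, ∑ j, a i * a j * L i j
  have hG : Continuous G := by fun_prop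
  obtain ⟨a, ha, hmax⟩ := (isCompact_stdSimplex (𝕜 := ℝ) ι).exists_isMaxOn ⟨a₀, ha₀⟩ hG.continuousOn
  refine ⟨a, ha, hmax ha₀, fun k hk => ?_⟩
  set g := ∑ i, ∑ j, a i * a j * L i j with hg
  set r := ∑ j, a j * L k j with hr
  by_contra! hlt
  set c := g - 2 * r + L k k with hc
  -- The competitor `(1 + s) a - s e_k` moves away from the vertex `k` and stays in the simplex
  -- because `s ≤ a k`. It changes the form by `s (2 (g - r) + s c)`, which is positive since `s |c|
  -- ≤ g - r`.
  set s := min (a k) ((g - r) / (|c| + 1)) with hs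
  have hd : 0 < g - r := sub_pos.2 hlt
  have hc0 : 0 < |c| + 1 := by positivity
  have hs0 : 0 < s := lt_min hk (div_pos hd hc0)
  have hsa : s ≤ a k := min_le_left _ _
  have hsd : s * (|c| + 1) ≤ g - r := (le_div_iff₀ hc0).1 (min_le_right _ _)
  let b : ι → ℝ := fun j => (1 + s) * a j - s * (if j = k then 1 else 0)
  have hb : b ∈ stdSimplex ℝ ι := by
    refine ⟨fun j => ?_, ?_⟩
    · simp only [b]
      have := mul_nonneg hs0.le (ha.1 j)
      split_ifs with h
      · subst h
        linarith
      · linarith [ha.1 j]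
    · simp only [b, Finset.sum_sub_distrib, ← Finset.mul_sum, ha.2, Finset.sum_ite_eq',
        Finset.mem_univ, if_true]
      ring
  have hGb : G b = (1 + s) ^ 2 * g - 2 * s * (1 + s) * r + s ^ 2 * L k k := by
    have h1 : ∀ i j, b i * b j * L i j = (1 + s) ^ 2 * (a i * a j * L i j)
        - s * (1 + s) * ((if i = k then a j * L i j else 0))
        - s * (1 + s) * ((if j = k then a i * L i j else 0))
        + s ^ 2 * (if i = k then (if j = k then L i j else 0) else 0) := by
      intro i j
      simp only [b]
      split_ifs <;> ring
    have h2 : ∀ j, L j k = L k j := fun j => hL j k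
    simp only [G, h1, Finset.sum_add_distrib, Finset.sum_sub_distrib, ← Finset.mul_sum,
      Finset.sum_ite_irrel, Finset.sum_const_zero, Finset.sum_ite_eq', Finset.mem_univ, if_true, h2]
    rw [← hg, ← hr]
    ring
  have h3 : G b ≤ g := hmax hb
  rw [hGb] at h3
  have h4 : s * (2 * (g - r) + s * c) ≤ 0 := by rw [hc]; linarith
  have h5 : 2 * (g - r) + s * c ≤ 0 := nonpos_of_mul_nonpos_right h4 hs0
  have h6 : -(s * |c|) ≤ s * c := by
    have := mul_le_mul_of_nonneg_left (neg_abs_le c) hs0.le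
    linarith
  linarith

theorem logAvg_concave {a h : ℝ} (hh : 0 < h) {p q α β : ℝ} (hα : 0 ≤ α) (hβ : 0 ≤ β)
    (hαβ : α + β = 1) (hpq : p < q) (hout : a + h ≤ p ∨ q ≤ a) :
    α * logAvg a h (p : ℂ) + β * logAvg a h (q : ℂ) ≤ logAvg a h ((α * p + β * q : ℝ) : ℂ) := by
  have h1 : ∫ t in a..a + h, (α * Real.log ‖(p : ℂ) - (t : ℂ)‖ + β * Real.log ‖(q : ℂ) - (t : ℂ)‖) ≤
      ∫ t in a..a + h, Real.log ‖((α * p + β * q : ℝ) : ℂ) - (t : ℂ)‖ := by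
    refine intervalIntegral.integral_mono_ae_restrict (by linarith)
      (((intervalIntegrable_log_norm_sub _ _ _).const_mul _).add
        ((intervalIntegrable_log_norm_sub _ _ _).const_mul _))
      (intervalIntegrable_log_norm_sub _ _ _) ?_
    filter_upwards [ae_restrict_mem measurableSet_Icc, ae_restrict_of_ae (ae_ofReal_ne p),
      ae_restrict_of_ae (ae_ofReal_ne q)] with t ht htp htq
    have htp : t ≠ p := fun h => htp (by rw [h])
    have htq : t ≠ q := fun h => htq (by rw [h])
    simp only [norm_ofReal_sub_ofReal, Real.log_abs]
    have hconc := strictConcaveOn_log_Ioi.concaveOn.2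
    rcases hout with h | h
    · have h1 : t < p := lt_of_le_of_ne (ht.2.trans h) htp
      have := hconc (x := p - t) (sub_pos.2 h1) (y := q - t) (sub_pos.2 (h1.trans hpq)) hα hβ hαβ
      simp only [smul_eq_mul] at this
      have e : α * (p - t) + β * (q - t) = α * p + β * q - t := by
        linear_combination (-t) * hαβ
      rwa [e] at this
    · have h1 : q < t := lt_of_le_of_ne (h.trans ht.1) htq.symm
      have := hconc (x := t - p) (sub_pos.2 (hpq.trans h1)) (y := t - q) (sub_pos.2 h1) hα hβ hαβ
      simp only [smul_eq_mul] at this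
      rw [← Real.log_neg_eq_log (p - t), ← Real.log_neg_eq_log (q - t),
        ← Real.log_neg_eq_log (_ - t), neg_sub, neg_sub, neg_sub]
      have e : α * (t - p) + β * (t - q) = t - (α * p + β * q) := by
        linear_combination t * hαβ
      rwa [e] at this
  rw [intervalIntegral.integral_add ((intervalIntegrable_log_norm_sub _ _ _).const_mul _)
    ((intervalIntegrable_log_norm_sub _ _ _).const_mul _), intervalIntegral.integral_const_mul,
    intervalIntegral.integral_const_mul] at h1
  have h2 := mul_le_mul_of_nonneg_left h1 (inv_nonneg.2 hh.le)
  simp only [logAvg]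
  linarith

/-- The maximum principle on the line: a lower bound for the logarithmic integral on the support
of a mixture of uniform measures holds everywhere. -/
theorem le_sum_logAvg_of_le_on_support {ι : Type*} (F : Finset ι) (hF : F.Nonempty) (b a : ι → ℝ)
    {h : ℝ} (hh : 0 < h) (ha : ∀ i ∈ F, 0 ≤ a i) {δ : ℝ}
    (H : ∀ i ∈ F, ∀ x ∈ Set.Icc (b i) (b i + h), δ ≤ ∑ j ∈ F, a j * logAvg (b j) h (x : ℂ))
    (x : ℝ) : δ ≤ ∑ j ∈ F, a j * logAvg (b j) h (x : ℂ) := by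
  classical
  by_cases hx : ∃ i ∈ F, x ∈ Set.Icc (b i) (b i + h)
  · obtain ⟨i, hi, hxi⟩ := hx
    exact H i hi x hxi
  push Not at hx
  have hx' : ∀ i ∈ F, b i + h < x ∨ x < b i := by
    intro i hi
    by_contra! hc
    exact hx i hi ⟨hc.2, hc.1⟩
  set A := F.filter fun i => b i + h < x with hA
  set B := F.filter fun i => x < b i with hB
  rcases A.eq_empty_or_nonempty with hAe | hAne
  -- Here `x` lies to the left of every cell, and moving right to the leftmost endpoint shortens all
  -- distances. The mirror case follows.
  · obtain ⟨i, hi, hmin⟩ := F.exists_min_image b hF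
    refine (H i hi (b i) ⟨le_rfl, by linarith⟩).trans
      (Finset.sum_le_sum fun j hj => mul_le_mul_of_nonneg_left ?_ (ha j hj))
    have hxb : ∀ j ∈ F, x < b j := by
      intro j hj
      refine (hx' j hj).resolve_left fun h => ?_
      have : j ∈ A := Finset.mem_filter.2 ⟨hj, h⟩
      simp [hAe] at this
    rw [← add_zero (logAvg (b j) h (x : ℂ))]
    refine logAvg_le_logAvg_add hh fun t ht h1 h2 => ?_
    have htb : t ≠ b i := fun h => h1 (by rw [h])
    have h3 : b i < t := lt_of_le_of_ne ((hmin j hj).trans ht.1) htb.symm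
    rw [add_zero, norm_ofReal_sub_ofReal, norm_ofReal_sub_ofReal, abs_of_neg (by linarith),
      abs_of_neg (by linarith [hxb i hi])]
    exact Real.log_le_log (by linarith) (by linarith [hxb i hi])
  rcases B.eq_empty_or_nonempty with hBe | hBne
  · obtain ⟨i, hi, hmax⟩ := F.exists_max_image b hF
    refine (H i hi (b i + h) ⟨by linarith, le_rfl⟩).trans
      (Finset.sum_le_sum fun j hj => mul_le_mul_of_nonneg_left ?_ (ha j hj))
    have hxb : ∀ j ∈ F, b j + h < x := by
      intro j hj
      refine (hx' j hj).resolve_right fun h => ?_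
      have : j ∈ B := Finset.mem_filter.2 ⟨hj, h⟩
      simp [hBe] at this
    rw [← add_zero (logAvg (b j) h (x : ℂ))]
    refine logAvg_le_logAvg_add hh fun t ht h1 h2 => ?_
    have htb : t ≠ b i + h := fun h => h1 (by rw [h])
    have h3 : t < b i + h := lt_of_le_of_ne (ht.2.trans (by linarith [hmax j hj])) htb
    rw [add_zero, norm_ofReal_sub_ofReal, norm_ofReal_sub_ofReal, abs_of_pos (by linarith),
      abs_of_pos (by linarith [hxb i hi])]
    exact Real.log_le_log (by linarith) (by linarith [hxb i hi])
  -- Now `x` is in a gap, a convex combination of the endpoints bordering it. No cell meets the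
  -- interior of the gap, so each average is concave there.
  obtain ⟨i, hi, hmax⟩ := A.exists_max_image b hAne
  obtain ⟨k, hk, hmin⟩ := B.exists_min_image b hBne
  obtain ⟨hiF, hix⟩ := Finset.mem_filter.1 hi
  obtain ⟨hkF, hkx⟩ := Finset.mem_filter.1 hk
  have hpq : b i + h < b k := hix.trans hkx
  have hqp : 0 < b k - (b i + h) := by linarith
  set α := (b k - x) / (b k - (b i + h)) with hα
  set β := (x - (b i + h)) / (b k - (b i + h)) with hβ
  have hα0 : 0 ≤ α := div_nonneg (by linarith) hqp.le
  have hβ0 : 0 ≤ β := div_nonneg (by linarith) hqp.le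
  have hαβ : α + β = 1 := by
    rw [hα, hβ, ← add_div, div_eq_one_iff_eq hqp.ne']
    ring
  have hxc : x = α * (b i + h) + β * b k := by
    rw [hα, hβ]
    field_simp
    ring
  have h1 := mul_le_mul_of_nonneg_left (H i hiF (b i + h) ⟨by linarith, le_rfl⟩) hα0
  have h2 := mul_le_mul_of_nonneg_left (H k hkF (b k) ⟨le_rfl, by linarith⟩) hβ0
  calc δ = α * δ + β * δ := by rw [← add_mul, hαβ, one_mul]
    _ ≤ _ := add_le_add h1 h2
    _ = ∑ j ∈ F, a j * (α * logAvg (b j) h ((b i + h : ℝ) : ℂ) + β * logAvg (b j) h (b k : ℂ)) := by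
      rw [Finset.mul_sum, Finset.mul_sum, ← Finset.sum_add_distrib]
      exact Finset.sum_congr rfl fun j _ => by ring
    _ ≤ _ := by
      refine Finset.sum_le_sum fun j hj => mul_le_mul_of_nonneg_left ?_ (ha j hj)
      conv_rhs => rw [hxc]
      refine logAvg_concave hh hα0 hβ0 hαβ hpq ?_
      rcases hx' j hj with h | h
      · left
        have := hmax j (Finset.mem_filter.2 ⟨hj, h⟩)
        linarith
      · right
        exact hmin j (Finset.mem_filter.2 ⟨hj, h⟩)

theorem logAvg₂_le_logAvg_add_of_far {h : ℝ} (hh : 0 < h) {N : ℕ} (hN : 1 ≤ N) {k l : ℤ}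
    (hkl : (N : ℤ) + 1 ≤ |l - k|) {x : ℝ} (hx : x ∈ Set.Icc (k * h) (k * h + h)) :
    logAvg₂ (k * h) (l * h) h ≤ logAvg (l * h) h (x : ℂ) + 1 / N := by
  have hN0 : (0 : ℝ) < N := by exact_mod_cast hN
  refine logAvg₂_le hh fun s hs => logAvg_le_logAvg_add hh fun t ht h1 h2 => ?_
  have hts : t ≠ s := fun h => h1 (by rw [h])
  have htx : t ≠ x := fun h => h2 (by rw [h])
  rw [norm_ofReal_sub_ofReal, norm_ofReal_sub_ofReal]
  have hpos : 0 < |x - t| := abs_pos.2 (sub_ne_zero.2 htx.symm)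
  have h3 : |s - t| ≤ |x - t| + h := by
    have h4 : |s - x| ≤ h := by
      rw [abs_le]
      constructor <;> linarith [hs.1, hs.2, hx.1, hx.2]
    have := abs_sub_le s x t
    linarith
  have h5 : N * h ≤ |x - t| := by
    rcases le_abs.1 hkl with h | h
    · have h' : (N : ℝ) + 1 ≤ l - k := by exact_mod_cast h
      have := mul_le_mul_of_nonneg_right h' hh.le
      rw [abs_sub_comm]
      refine le_trans ?_ (le_abs_self _)
      linarith [ht.1, hx.2]
    · have h' : (N : ℝ) + 1 ≤ -(l - k) := by exact_mod_cast h
      have := mul_le_mul_of_nonneg_right h' hh.le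
      refine le_trans ?_ (le_abs_self _)
      linarith [ht.2, hx.1]
  have h6 : Real.log |s - t| ≤ Real.log (|x - t| * (1 + 1 / N)) := by
    refine Real.log_le_log (abs_pos.2 (sub_ne_zero.2 hts.symm)) (h3.trans ?_)
    have : h ≤ |x - t| * (1 / N) := by
      rw [mul_one_div, le_div_iff₀ hN0]
      linarith
    linarith
  rw [Real.log_mul hpos.ne' (by positivity)] at h6
  have h7 := Real.log_le_sub_one_of_pos (show (0 : ℝ) < 1 + 1 / N by positivity)
  linarith

theorem logAvg₂_le_log_of_near {h : ℝ} (hh : 0 < h) {N : ℕ} {k l : ℤ} (hkl : |l - k| ≤ N) :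
    logAvg₂ (k * h) (l * h) h ≤ Real.log ((N + 1) * h) := by
  refine logAvg₂_le hh fun s hs => logAvg_le hh fun t ht h1 => ?_
  have hts : t ≠ s := fun h => h1 (by rw [h])
  rw [norm_ofReal_sub_ofReal]
  refine Real.log_le_log (abs_pos.2 (sub_ne_zero.2 hts.symm)) ?_
  obtain ⟨h2, h3⟩ := abs_le.1 hkl
  have h2' : -(N : ℝ) ≤ l - k := by exact_mod_cast h2
  have h3' : (l : ℝ) - k ≤ N := by exact_mod_cast h3
  have h4 := mul_le_mul_of_nonneg_right h2' hh.le
  have h5 := mul_le_mul_of_nonneg_right h3' hh.le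
  rw [abs_le]
  constructor <;> linarith [ht.1, ht.2, hs.1, hs.2]

/-- The first-order condition is only available at positive weights; discarding the indices of
weight zero makes it hold on the whole index set. -/
theorem exists_maximizer_finset {ι : Type*} (F : Finset ι) (L : ι → ι → ℝ)
    (hL : ∀ i j, L i j = L j i) {a₀ : ι → ℝ} (ha₀ : ∀ i ∈ F, 0 ≤ a₀ i) (ha₁ : ∑ i ∈ F, a₀ i = 1) :
    ∃ F' ⊆ F, ∃ a : ι → ℝ, (∀ i ∈ F', 0 < a i) ∧ ∑ i ∈ F', a i = 1 ∧
      (∑ i ∈ F, ∑ j ∈ F, a₀ i * a₀ j * L i j ≤ ∑ i ∈ F', ∑ j ∈ F', a i * a j * L i j) ∧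
      ∀ k ∈ F', ∑ i ∈ F', ∑ j ∈ F', a i * a j * L i j ≤ ∑ j ∈ F', a j * L k j := by
  classical
  have hmem : (fun i : F => a₀ i) ∈ stdSimplex ℝ F :=
    ⟨fun i => ha₀ i i.2, by rw [Finset.sum_coe_sort F a₀, ha₁]⟩
  obtain ⟨b, hb, hle, hkkt⟩ := exists_maximizer_stdSimplex (fun i j : F => L i j)
    (fun i j => hL i j) hmem
  let a : ι → ℝ := fun i => if h : i ∈ F then b ⟨i, h⟩ else 0
  have hab : ∀ i : F, b i = a i := fun i => by simp [a]
  have ha0 : ∀ i ∈ F, 0 ≤ a i := fun i hi => by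
    rw [← hab ⟨i, hi⟩]
    exact hb.1 _
  set F' := F.filter fun i => 0 < a i with hF'
  have hsum : ∀ f : ι → ℝ, ∑ i : F, b i * f i = ∑ i ∈ F', a i * f i := by
    intro f
    simp only [hab]
    rw [Finset.sum_coe_sort F fun i => a i * f i]
    refine (Finset.sum_subset (Finset.filter_subset _ _) fun i hi hi' => ?_).symm
    have : ¬ 0 < a i := fun h => hi' (Finset.mem_filter.2 ⟨hi, h⟩)
    rw [le_antisymm (not_lt.1 this) (ha0 i hi), zero_mul]
  have hG : ∑ i : F, ∑ j : F, b i * b j * L i j = ∑ i ∈ F', ∑ j ∈ F', a i * a j * L i j := by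
    have h1 : ∀ i : F, ∑ j : F, b i * b j * L i j = b i * ∑ j ∈ F', a j * L i j := fun i => by
      rw [← hsum, Finset.mul_sum]
      exact Finset.sum_congr rfl fun j _ => by ring
    simp only [h1]
    rw [hsum fun i => ∑ j ∈ F', a j * L i j]
    refine Finset.sum_congr rfl fun i _ => ?_
    rw [Finset.mul_sum]
    exact Finset.sum_congr rfl fun j _ => by ring
  refine ⟨F', Finset.filter_subset _ _, a, fun i hi => (Finset.mem_filter.1 hi).2, ?_, ?_, ?_⟩
  · have := hsum fun _ => 1
    simp only [mul_one] at this
    rw [← this, hb.2]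
  · rw [← hG]
    have h1 : ∀ i : F, ∑ j : F, a₀ i * a₀ j * L i j = ∑ j ∈ F, a₀ i * a₀ j * L i j :=
      fun i => Finset.sum_coe_sort F fun j => a₀ i * a₀ j * L i j
    simp only [h1] at hle
    rwa [Finset.sum_coe_sort F fun i => ∑ j ∈ F, a₀ i * a₀ j * L i j] at hle
  · intro k hk
    obtain ⟨hkF, hk0⟩ := Finset.mem_filter.1 hk
    have := hkkt ⟨k, hkF⟩ (by rwa [hab])
    rwa [hG, hsum fun j => L k j] at this

/-- A compact set carrying grid mixtures of uniformly negative logarithmic energy carries a grid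
mixture whose logarithmic integral is positive and bounded away from zero on the plane. -/
theorem exists_grid_mixture_pos {S : Set ℝ} {D : ℝ} (hD : 1 ≤ D)
    (hS : ∀ x ∈ S, ∀ y ∈ S, |x - y| ≤ D) {E : ℝ} (hE : 0 < E)
    (H : ∀ᶠ h in 𝓝[>] (0 : ℝ), ∃ (F : Finset ℤ) (a : ℤ → ℝ),
      (∀ k ∈ F, k ∈ gridIndices S h) ∧ (∀ k ∈ F, 0 ≤ a k) ∧ ∑ k ∈ F, a k = 1 ∧
      E ≤ ∑ k ∈ F, ∑ l ∈ F, a k * a l * logAvg₂ (k * h) (l * h) h) :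
    ∃ (h : ℝ) (F : Finset ℤ) (a : ℤ → ℝ) (δ : ℝ), 0 < h ∧ 0 < δ ∧
      (∀ k ∈ F, k ∈ gridIndices S h) ∧ (∀ k ∈ F, 0 < a k) ∧ ∑ k ∈ F, a k = 1 ∧
      ∀ z : ℂ, δ ≤ ∑ k ∈ F, a k * logAvg (k * h) h z := by
  classical
  -- Cells more than `N` apart cost `1 / N ≤ E / 4` in passing from the cell average to a point.
  -- Nearer cells cost at most `c` per unit of mass, and `ε` is chosen so that `c ε = E / 4`. Half
  -- of `E` remains.
  obtain ⟨N, hN⟩ := exists_nat_gt (max 1 (4 / E))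
  have hN1 : (1 : ℝ) < N := (le_max_left _ _).trans_lt hN
  have hN1' : 1 ≤ N := by exact_mod_cast hN1.le
  have hN0 : (0 : ℝ) < N := by linarith
  have hNE : 1 / (N : ℝ) ≤ E / 4 := by
    rw [div_le_iff₀ hN0]
    have := (le_max_right _ _).trans_lt hN
    rw [div_lt_iff₀ hE] at this
    linarith
  set c := Real.log (N + 1) + 2 with hc
  have hc0 : 0 < c := by
    have := Real.log_nonneg (show (1 : ℝ) ≤ N + 1 by linarith)
    linarith
  set ε := E / (4 * c) with hε
  have hε0 : 0 < ε := by positivity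
  have hεc : c * ε = E / 4 := by rw [hε]; field_simp
  have hB : 0 ≤ Real.log D := Real.log_nonneg hD
  have hlim : ∀ᶠ h in 𝓝[>] (0 : ℝ), Real.log (((2 * N : ℕ) + 1) * h) < -(Real.log D / ε ^ 2) := by
    have h1 : Tendsto (fun h : ℝ => (((2 * N : ℕ) + 1 : ℝ)) * h) (𝓝[>] 0) (𝓝[>] 0) := by
      refine tendsto_nhdsWithin_iff.2 ⟨?_, ?_⟩
      · have : Tendsto (fun h : ℝ => (((2 * N : ℕ) + 1 : ℝ)) * h) (𝓝 0) (𝓝 0) := by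
          simpa using (tendsto_id (α := ℝ) (x := 𝓝 0)).const_mul (((2 * N : ℕ) + 1 : ℝ))
        exact this.mono_left nhdsWithin_le_nhds
      · filter_upwards [self_mem_nhdsWithin] with h hh
        have hh : 0 < h := hh
        exact mul_pos (by positivity) hh
    exact (Real.tendsto_log_nhdsGT_zero.comp h1).eventually (eventually_lt_atBot _)
  obtain ⟨h, ⟨F₀, a₀, hF₀, ha₀, hs₀, hE₀⟩, hlog, hh⟩ :=
    (H.and (hlim.and self_mem_nhdsWithin)).exists
  have hh : 0 < h := hh
  obtain ⟨F, hFF, a, ha, hs, hle, hkkt⟩ := exists_maximizer_finset F₀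
    (fun k l => logAvg₂ (k * h) (l * h) h) (fun k l => logAvg₂_comm hh _ _) ha₀ hs₀
  have hF : ∀ k ∈ F, k ∈ gridIndices S h := fun k hk => hF₀ k (hFF hk)
  have hEF := hE₀.trans hle
  set G := ∑ k ∈ F, ∑ l ∈ F, a k * a l * logAvg₂ (k * h) (l * h) h with hG
  have hFne : F.Nonempty := by
    rw [Finset.nonempty_iff_ne_empty]
    rintro rfl
    simp at hs
  have hlogneg : Real.log (((2 * N : ℕ) + 1) * h) < 0 :=
    hlog.trans_le (neg_nonpos.2 (by positivity))
  -- Two cells of such a window are at most `2 N` apart, so a window of mass above `ε` would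
  -- contribute at most `ε² log ((2 N + 1) h) < -log D`. Everything else is bounded by `log D`, and
  -- `G` would be negative.
  have hnear : ∀ k : ℤ, ∑ l ∈ F with |l - k| ≤ N, a l ≤ ε := by
    intro k
    set T := F.filter fun l => |l - k| ≤ N with hT
    set m := ∑ l ∈ T, a l with hm
    have hm0 : 0 ≤ m := Finset.sum_nonneg fun l hl => (ha l (Finset.mem_filter.1 hl).1).le
    have h1 : G ≤ Real.log D + m ^ 2 * Real.log (((2 * N : ℕ) + 1) * h) := by
      have h2 : ∀ i ∈ F, ∀ j ∈ F, a i * a j * logAvg₂ (i * h) (j * h) h ≤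
          a i * a j * Real.log D + (if i ∈ T then a i else 0) * (if j ∈ T then a j else 0) *
            Real.log (((2 * N : ℕ) + 1) * h) := by
        intro i hi j hj
        have hij : 0 ≤ a i * a j := mul_nonneg (ha i hi).le (ha j hj).le
        by_cases hTT : i ∈ T ∧ j ∈ T
        · rw [if_pos hTT.1, if_pos hTT.2, ← mul_add]
          refine mul_le_mul_of_nonneg_left ?_ hij
          have h3 : |j - i| ≤ ((2 * N : ℕ) : ℤ) := by
            have e1 := (Finset.mem_filter.1 hTT.1).2
            have e2 := (Finset.mem_filter.1 hTT.2).2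
            rw [abs_le] at e1 e2 ⊢
            push_cast
            constructor <;> linarith
          linarith [logAvg₂_le_log_of_near hh h3]
        · have h0 : (if i ∈ T then a i else 0) * (if j ∈ T then a j else 0) = 0 := by
            rw [not_and_or] at hTT
            rcases hTT with h | h <;> simp [h]
          rw [h0, zero_mul, add_zero]
          refine mul_le_mul_of_nonneg_left ?_ hij
          refine logAvg₂_le hh fun s hs => logAvg_le hh fun t ht hts => ?_
          rw [norm_ofReal_sub_ofReal]
          exact Real.log_le_log (abs_pos.2 (sub_ne_zero.2 fun h => hts (by rw [h])))
            (hS s (hF i hi hs) t (hF j hj ht))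
      have hmT : ∑ i ∈ F, (if i ∈ T then a i else 0) = m := by
        rw [← Finset.sum_filter, hm]
        refine Finset.sum_congr ?_ fun _ _ => rfl
        ext i
        simp [hT]
      calc G ≤ ∑ i ∈ F, ∑ j ∈ F, (a i * a j * Real.log D +
            (if i ∈ T then a i else 0) * (if j ∈ T then a j else 0) *
              Real.log (((2 * N : ℕ) + 1) * h)) :=
            Finset.sum_le_sum fun i hi => Finset.sum_le_sum fun j hj => h2 i hi j hj
        _ = _ := by
          simp only [Finset.sum_add_distrib, ← Finset.sum_mul, ← Finset.mul_sum, hs, hmT]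
          ring
    by_contra! hgt
    have h3 : ε ^ 2 ≤ m ^ 2 := pow_le_pow_left₀ hε0.le hgt.le 2
    have h4 : m ^ 2 * Real.log (((2 * N : ℕ) + 1) * h) ≤
        ε ^ 2 * Real.log (((2 * N : ℕ) + 1) * h) := mul_le_mul_of_nonpos_right h3 hlogneg.le
    have h5 : ε ^ 2 * Real.log (((2 * N : ℕ) + 1) * h) < -Real.log D := by
      have := mul_lt_mul_of_pos_left hlog (show 0 < ε ^ 2 by positivity)
      rwa [mul_neg, mul_div_cancel₀ _ (by positivity)] at this
    linarith
  refine ⟨h, F, a, E / 2, hh, half_pos hE, hF, ha, hs, fun z => ?_⟩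
  have hre : E / 2 ≤ ∑ k ∈ F, a k * logAvg (k * h) h (z.re : ℂ) := by
    refine le_sum_logAvg_of_le_on_support F hFne (fun k : ℤ => (k : ℝ) * h) a hh
      (fun k hk => (ha k hk).le) ?_ z.re
    intro k hk x hx
    -- For near cells the terms `log h` in the upper bound for the double average and in the lower
    -- bound for the single one cancel, leaving `c = log (N + 1) + 2`, independent of the mesh.
    have h1 : ∀ l ∈ F, a l * logAvg₂ (k * h) (l * h) h ≤ a l * logAvg (l * h) h (x : ℂ) +
        a l * (1 / N) + (if |l - k| ≤ N then a l else 0) * c := by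
      intro l hl
      split_ifs with hkl
      · rw [← mul_add, ← mul_add]
        refine mul_le_mul_of_nonneg_left ?_ (ha l hl).le
        have h2 := logAvg₂_le_log_of_near hh hkl
        have h3 := log_sub_two_le_logAvg hh (l * h) (x : ℂ)
        rw [Real.log_mul (by positivity) hh.ne'] at h2
        have : 0 ≤ 1 / (N : ℝ) := by positivity
        linarith
      · rw [zero_mul, add_zero, ← mul_add]
        refine mul_le_mul_of_nonneg_left ?_ (ha l hl).le
        exact logAvg₂_le_logAvg_add_of_far hh hN1' (by push Not at hkl; omega) hx
    have h2 := hEF.trans ((hkkt k hk).trans (Finset.sum_le_sum h1))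
    simp only [Finset.sum_add_distrib, ← Finset.sum_mul, hs, ← Finset.sum_filter] at h2
    have h3 := mul_le_mul_of_nonneg_left (hnear k) hc0.le
    linarith
  exact hre.trans (Finset.sum_le_sum fun k hk =>
    mul_le_mul_of_nonneg_left (logAvg_re_le hh z) (ha k hk).le)

/-! ### Finite unions of intervals and measures of bounded density -/

/-- A finite nonempty union of nondegenerate compact intervals. -/
def IsFiniteIntervalUnion (P : Set ℝ) : Prop :=
  ∃ T : Finset (ℝ × ℝ), T.Nonempty ∧ (∀ p ∈ T, p.1 < p.2) ∧ P = ⋃ p ∈ T, Set.Icc p.1 p.2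

theorem IsFiniteIntervalUnion.union {P Q : Set ℝ} (hP : IsFiniteIntervalUnion P)
    (hQ : IsFiniteIntervalUnion Q) : IsFiniteIntervalUnion (P ∪ Q) := by
  classical
  obtain ⟨T, hT, hlt, rfl⟩ := hP
  obtain ⟨T', hT', hlt', rfl⟩ := hQ
  refine ⟨T ∪ T', hT.mono Finset.subset_union_left, fun p hp => ?_, ?_⟩
  · rcases Finset.mem_union.1 hp with h | h
    exacts [hlt p h, hlt' p h]
  · exact (Finset.set_biUnion_union T T' _).symm

theorem isFiniteIntervalUnion_biUnion {ι : Type*} {F : Finset ι} (hF : F.Nonempty) (b : ι → ℝ)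
    {h : ℝ} (hh : 0 < h) : IsFiniteIntervalUnion (⋃ i ∈ F, Set.Icc (b i) (b i + h)) := by
  classical
  refine ⟨F.image fun i => (b i, b i + h), hF.image _, fun p hp => ?_, ?_⟩
  · obtain ⟨i, -, rfl⟩ := Finset.mem_image.1 hp
    simpa using hh
  · rw [Finset.set_biUnion_finset_image]

theorem IsFiniteIntervalUnion.isCompact {P : Set ℝ} (hP : IsFiniteIntervalUnion P) :
    IsCompact P := by
  obtain ⟨T, -, -, rfl⟩ := hP
  exact T.isCompact_biUnion fun p _ => isCompact_Icc

theorem IsFiniteIntervalUnion.isCompactFiniteUnionOfIntervals {P : Set ℝ}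
    (hP : IsFiniteIntervalUnion P) : IsCompactFiniteUnionOfIntervals P := by
  have hc := hP.isCompact
  obtain ⟨T, ⟨p₀, hp₀⟩, hlt, hPT⟩ := hP
  have hsub : ∀ p ∈ T, Set.Icc p.1 p.2 ⊆ P := fun p hp => by
    rw [hPT]
    exact Set.subset_biUnion_of_mem (u := fun p : ℝ × ℝ => Set.Icc p.1 p.2) hp
  have hl : ∀ p ∈ T, p.1 ∈ Set.Icc p.1 p.2 := fun p hp => ⟨le_rfl, (hlt p hp).le⟩
  refine ⟨hc, ⟨p₀.1, hsub p₀ hp₀ (hl p₀ hp₀)⟩, ?_, ?_⟩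
  · let f : T → ConnectedComponents P := fun p =>
      ConnectedComponents.mk ⟨p.1.1, hsub p.1 p.2 (hl p.1 p.2)⟩
    refine Finite.of_surjective f fun c => ?_
    obtain ⟨⟨x, hx⟩, rfl⟩ := ConnectedComponents.surjective_coe c
    have hx' := hx
    rw [hPT] at hx'
    obtain ⟨p, hp, hxp⟩ := Set.mem_iUnion₂.1 hx'
    refine ⟨⟨p, hp⟩, ?_⟩
    have : PreconnectedSpace (Set.Icc p.1 p.2) :=
      isPreconnected_iff_preconnectedSpace.1 isPreconnected_Icc
    have hcont : Continuous fun y : Set.Icc p.1 p.2 =>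
        (ConnectedComponents.mk (Set.inclusion (hsub p hp) y) : ConnectedComponents P) :=
      ConnectedComponents.continuous_coe.comp (continuous_inclusion _)
    have hpre := (isPreconnected_univ (α := Set.Icc p.1 p.2)).image _ hcont.continuousOn
    exact hpre.subsingleton ⟨⟨p.1, hl p hp⟩, trivial, rfl⟩ ⟨⟨x, hxp⟩, trivial, rfl⟩
  · intro x hx
    have hx' := hx
    rw [hPT] at hx'
    obtain ⟨p, hp, hxp⟩ := Set.mem_iUnion₂.1 hx'
    have hperf : Preperfect (Set.Icc p.1 p.2) :=
      isPreconnected_Icc.preperfect_of_nontrivial ((Set.nontrivial_pair (hlt p hp).ne).mono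
        (Set.pair_subset (hl p hp) ⟨(hlt p hp).le, le_rfl⟩))
    exact (hperf x hxp).mono (principal_mono.2 (hsub p hp))

/-- A measure dominated by a multiple of Lebesgue measure on `P`. -/
def HasBoundedDensityOn (μ : Measure ℝ) (P : Set ℝ) : Prop :=
  ∃ C : NNReal, μ ≤ (C : ENNReal) • volume.restrict P

namespace HasBoundedDensityOn

variable {μ ν : Measure ℝ} {P Q : Set ℝ}

theorem mono (hμ : HasBoundedDensityOn μ P) (hPQ : P ⊆ Q) : HasBoundedDensityOn μ Q := by
  obtain ⟨C, hC⟩ := hμ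
  refine ⟨C, hC.trans ?_⟩
  gcongr

theorem zero (P : Set ℝ) : HasBoundedDensityOn 0 P := ⟨0, by simp⟩

theorem add (hμ : HasBoundedDensityOn μ P) (hν : HasBoundedDensityOn ν P) :
    HasBoundedDensityOn (μ + ν) P := by
  obtain ⟨C, hC⟩ := hμ
  obtain ⟨C', hC'⟩ := hν
  refine ⟨C + C', ?_⟩
  rw [ENNReal.coe_add, add_smul]
  exact add_le_add hC hC'

theorem smul (hμ : HasBoundedDensityOn μ P) {c : ENNReal} (hc : c ≠ ⊤) :
    HasBoundedDensityOn (c • μ) P := by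
  obtain ⟨C, hC⟩ := hμ
  lift c to NNReal using hc
  refine ⟨c * C, ?_⟩
  rw [ENNReal.coe_mul, mul_smul]
  gcongr

theorem sum {ι : Type*} {F : Finset ι} {m : ι → Measure ℝ}
    (h : ∀ i ∈ F, HasBoundedDensityOn (m i) P) : HasBoundedDensityOn (∑ i ∈ F, m i) P :=
  Finset.sum_induction m (fun μ => HasBoundedDensityOn μ P) (fun _ _ => add) (zero P) h

theorem absolutelyContinuous (hμ : HasBoundedDensityOn μ P) : μ ≪ volume.restrict P := by
  obtain ⟨C, hC⟩ := hμ
  exact (Measure.absolutelyContinuous_of_le hC).trans (Measure.smul_absolutelyContinuous)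

theorem ae_of_ae (hμ : HasBoundedDensityOn μ P) {p : ℝ → Prop} (hp : ∀ᵐ x : ℝ, p x) :
    ∀ᵐ x ∂μ, p x :=
  hμ.absolutelyContinuous.ae_le (ae_restrict_of_ae hp)

theorem ae_mem (hμ : HasBoundedDensityOn μ P) (hP : MeasurableSet P) : ∀ᵐ x ∂μ, x ∈ P :=
  hμ.absolutelyContinuous.ae_le (ae_restrict_mem hP)

theorem integrable (hμ : HasBoundedDensityOn μ P) {f : ℝ → ℝ} (hf : IntegrableOn f P) :
    Integrable f μ := by
  obtain ⟨C, hC⟩ := hμ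
  exact (Integrable.smul_measure hf (by simp)).mono_measure hC

theorem isHolderMeasure (hμ : HasBoundedDensityOn μ P) : IsHolderMeasure μ := by
  obtain ⟨C, hC⟩ := hμ
  -- The exponent is one; `C + 1` keeps the constant positive even if `C = 0`.
  refine ⟨C + 1, 1, by positivity, one_pos, fun x y hxy => ?_⟩
  calc μ (Set.Icc x y) ≤ ((C : ENNReal) • volume.restrict P) (Set.Icc x y) := hC _
    _ ≤ (C : ENNReal) * volume (Set.Icc x y) := by
      rw [Measure.smul_apply, smul_eq_mul]
      gcongr
      exact Measure.restrict_le_self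
    _ = ENNReal.ofReal (C * (y - x)) := by
      rw [Real.volume_Icc, ENNReal.ofReal_mul (NNReal.coe_nonneg C), ENNReal.ofReal_coe_nnreal]
    _ ≤ _ := by
      refine ENNReal.ofReal_le_ofReal ?_
      rw [Real.rpow_one, abs_of_nonneg (by linarith)]
      nlinarith

theorem support_subset (hμ : HasBoundedDensityOn μ P) (hP : IsClosed P) : μ.support ⊆ P :=
  Measure.support_subset_of_isClosed hP (hμ.ae_mem hP.measurableSet)

end HasBoundedDensityOn

/-- The uniform probability measure on `[a, a + h]`. -/
def unifMeasure (a h : ℝ) : Measure ℝ :=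
  ENNReal.ofReal h⁻¹ • volume.restrict (Set.Icc a (a + h))

theorem isProbabilityMeasure_unifMeasure (a : ℝ) {h : ℝ} (hh : 0 < h) :
    IsProbabilityMeasure (unifMeasure a h) := by
  refine ⟨?_⟩
  rw [unifMeasure, Measure.smul_apply, Measure.restrict_apply_univ, Real.volume_Icc, smul_eq_mul,
    ← ENNReal.ofReal_mul (inv_nonneg.2 hh.le), add_sub_cancel_left, inv_mul_cancel₀ hh.ne',
    ENNReal.ofReal_one]

theorem hasBoundedDensityOn_unifMeasure (a h : ℝ) :
    HasBoundedDensityOn (unifMeasure a h) (Set.Icc a (a + h)) :=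
  ⟨Real.toNNReal h⁻¹, le_rfl⟩

theorem integral_unifMeasure (a : ℝ) {h : ℝ} (hh : 0 < h) (f : ℝ → ℝ) :
    ∫ t, f t ∂(unifMeasure a h) = h⁻¹ * ∫ t in a..a + h, f t := by
  rw [unifMeasure, integral_smul_measure, ENNReal.toReal_ofReal (inv_nonneg.2 hh.le), smul_eq_mul,
    intervalIntegral.integral_of_le (by linarith), integral_Icc_eq_integral_Ioc]

theorem integral_log_unifMeasure (a : ℝ) {h : ℝ} (hh : 0 < h) (z : ℂ) :
    ∫ t, Real.log ‖z - (t : ℂ)‖ ∂(unifMeasure a h) = logAvg a h z :=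
  integral_unifMeasure a hh _

theorem integrableOn_log_norm_sub {P : Set ℝ} (hP : IsCompact P) (z : ℂ) :
    IntegrableOn (fun t : ℝ => Real.log ‖z - (t : ℂ)‖) P := by
  obtain ⟨R, hR⟩ := hP.isBounded.subset_closedBall 0
  rw [Real.closedBall_eq_Icc] at hR
  refine IntegrableOn.mono_set ?_ hR
  rcases le_or_gt (0 - R) (0 + R) with h | h
  · exact (intervalIntegrable_iff_integrableOn_Icc_of_le h).1 (intervalIntegrable_log_norm_sub _ _ _)
  · rw [Set.Icc_eq_empty (not_le.2 h)]
    exact integrableOn_empty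

theorem HasBoundedDensityOn.integrable_log_norm_sub {μ : Measure ℝ} {P : Set ℝ}
    (hμ : HasBoundedDensityOn μ P) (hP : IsCompact P) (z : ℂ) :
    Integrable (fun t : ℝ => Real.log ‖z - (t : ℂ)‖) μ :=
  hμ.integrable (integrableOn_log_norm_sub hP z)

/-- The mixture of the measures `m i` with weights `a i`. -/
def mixture {ι : Type*} (F : Finset ι) (a : ι → ℝ) (m : ι → Measure ℝ) : Measure ℝ :=
  ∑ i ∈ F, ENNReal.ofReal (a i) • m i

theorem isProbabilityMeasure_mixture {ι : Type*} {F : Finset ι} {a : ι → ℝ} {m : ι → Measure ℝ}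
    (ha : ∀ i ∈ F, 0 ≤ a i) (hs : ∑ i ∈ F, a i = 1) (hm : ∀ i, IsProbabilityMeasure (m i)) :
    IsProbabilityMeasure (mixture F a m) := by
  refine ⟨?_⟩
  simp only [mixture, Measure.finsetSum_apply, Measure.smul_apply, measure_univ, smul_eq_mul,
    mul_one]
  rw [← ENNReal.ofReal_sum_of_nonneg ha, hs, ENNReal.ofReal_one]

theorem hasBoundedDensityOn_mixture {ι : Type*} {F : Finset ι} {a : ι → ℝ} {m : ι → Measure ℝ}
    {P : Set ℝ} (hm : ∀ i ∈ F, HasBoundedDensityOn (m i) P) :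
    HasBoundedDensityOn (mixture F a m) P :=
  .sum fun i hi => (hm i hi).smul ENNReal.ofReal_ne_top

theorem integral_mixture {ι : Type*} {F : Finset ι} {a : ι → ℝ} {m : ι → Measure ℝ}
    (ha : ∀ i ∈ F, 0 ≤ a i) {f : ℝ → ℝ} (hf : ∀ i ∈ F, Integrable f (m i)) :
    ∫ x, f x ∂(mixture F a m) = ∑ i ∈ F, a i * ∫ x, f x ∂(m i) := by
  rw [mixture, integral_finsetSum_measure fun i hi =>
    (hf i hi).smul_measure ENNReal.ofReal_ne_top]
  refine Finset.sum_congr rfl fun i hi => ?_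
  rw [integral_smul_measure, ENNReal.toReal_ofReal (ha i hi), smul_eq_mul]

/-! ### The measure with logarithmic integral bounded below -/

/-- A compact set of capacity greater than one with countable boundary carries a measure of bounded
density whose logarithmic integral is positive and bounded away from zero on the plane. -/
theorem exists_boundedDensity_pos {S : Set ℝ} (hSc : IsCompact S)
    (hcount : (S \ interior S).Countable) (hcap : 1 < logCapacity S) :
    ∃ (ω : Measure ℝ) (P : Set ℝ) (δ : ℝ), IsProbabilityMeasure ω ∧ IsFiniteIntervalUnion P ∧
      P ⊆ S ∧ HasBoundedDensityOn ω P ∧ 0 < δ ∧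
      ∀ z : ℂ, δ ≤ ∫ t, Real.log ‖z - (t : ℂ)‖ ∂ω := by
  obtain ⟨D, hD, hS⟩ : ∃ D : ℝ, 1 ≤ D ∧ ∀ x ∈ S, ∀ y ∈ S, |x - y| ≤ D := by
    obtain ⟨D, hD⟩ := Metric.isBounded_iff.1 hSc.isBounded
    exact ⟨max D 1, le_max_right _ _, fun x hx y hy => (hD hx hy).trans (le_max_left _ _)⟩
  obtain ⟨ν, _, hνS, hint, hpos, hdiag⟩ := exists_measure_of_one_lt_logCapacity hcap hD hS
  obtain ⟨E, hE, hev⟩ := exists_grid_weights hSc hcount hνS hD hS hint hpos hdiag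
  obtain ⟨h, F, a, δ, hh, hδ, hF, ha, hs, hV⟩ := exists_grid_mixture_pos hD hS hE hev
  have hFne : F.Nonempty := by
    rw [Finset.nonempty_iff_ne_empty]
    rintro rfl
    simp at hs
  set P := ⋃ k ∈ F, Set.Icc ((k : ℝ) * h) (k * h + h) with hP
  have hPu : IsFiniteIntervalUnion P := isFiniteIntervalUnion_biUnion hFne (fun k : ℤ => k * h) hh
  have hbd : ∀ k ∈ F, HasBoundedDensityOn (unifMeasure (k * h) h) P := fun k hk =>
    (hasBoundedDensityOn_unifMeasure _ _).mono
      (Set.subset_biUnion_of_mem (u := fun k : ℤ => Set.Icc ((k : ℝ) * h) (k * h + h)) hk)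
  refine ⟨mixture F a fun k => unifMeasure (k * h) h, P, δ,
    isProbabilityMeasure_mixture (fun k hk => (ha k hk).le) hs
      fun k => isProbabilityMeasure_unifMeasure _ hh,
    hPu, Set.iUnion₂_subset hF, hasBoundedDensityOn_mixture hbd, hδ, fun z => ?_⟩
  rw [integral_mixture (fun k hk => (ha k hk).le)
    fun k hk => (hbd k hk).integrable_log_norm_sub hPu.isCompact z]
  simp only [integral_log_unifMeasure _ hh]
  exact hV z

/-! ### Small integer polynomials and absence of atoms -/

theorem abs_sum_mul_pow_le {n H : ℕ} {R : ℝ} (hR : 1 ≤ R) {d : Fin n → ℤ}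
    (hd : ∀ i, |d i| ≤ H) {x : ℝ} (hx : |x| ≤ R) :
    |∑ i, (d i : ℝ) * x ^ (i : ℕ)| ≤ H * (n * R ^ n) := by
  calc |∑ i, (d i : ℝ) * x ^ (i : ℕ)| ≤ ∑ i, |(d i : ℝ) * x ^ (i : ℕ)| :=
        Finset.abs_sum_le_sum_abs _ _
    _ ≤ ∑ _i : Fin n, (H : ℝ) * R ^ n := by
      refine Finset.sum_le_sum fun i _ => ?_
      rw [abs_mul, abs_pow]
      have h1 : |(d i : ℝ)| ≤ H := by exact_mod_cast hd i
      have h2 : |x| ^ (i : ℕ) ≤ R ^ n :=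
        (pow_le_pow_left₀ (abs_nonneg x) hx _).trans (pow_le_pow_right₀ hR i.2.le)
      exact mul_le_mul h1 h2 (by positivity) (by positivity)
    _ = _ := by
      rw [Finset.sum_const, Finset.card_univ, Fintype.card_fin, nsmul_eq_mul]
      ring

/-- Pigeonhole: an integer polynomial of bounded height that is small at a given point. -/
theorem exists_int_poly_small {n H : ℕ} (hn : 1 ≤ n) (hH : 3 ≤ H) {R : ℝ} (hR : 1 ≤ R) {α : ℝ}
    (hα : |α| ≤ R) : ∃ Q : ℤ[X], Q ≠ 0 ∧ (∀ x : ℝ, |x| ≤ R → |aeval x Q| ≤ H * (n * R ^ n)) ∧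
      |aeval α Q| ≤ 4 * (H * (n * R ^ n)) / (H : ℝ) ^ n := by
  classical
  have hn0 : (0 : ℝ) < n := by exact_mod_cast hn
  have hH0 : (0 : ℝ) < H := by
    have : 0 < H := by omega
    exact_mod_cast this
  set W : ℝ := H * (n * R ^ n) with hW
  have hW0 : 0 < W := by positivity
  have hHn : (0 : ℝ) < (H : ℝ) ^ n := by positivity
  -- The values at `α` lie in `[-W, W]`, which bins of width `w` cover with at most `H ^ n / 2 + 1`
  -- bins. This is less than the number `H ^ n` of coefficient vectors because `H ^ n ≥ 3`.
  set w : ℝ := 4 * W / (H : ℝ) ^ n with hw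
  have hw0 : 0 < w := by positivity
  let v : (Fin n → Fin H) → ℝ := fun c => ∑ i, (((c i : ℕ) : ℤ) : ℝ) * α ^ (i : ℕ)
  have hv : ∀ c, |v c| ≤ W := fun c => abs_sum_mul_pow_le hR (fun i => by
    rw [abs_of_nonneg (by positivity)]
    exact_mod_cast (c i).2.le) hα
  have hcard : (Finset.range (H ^ n / 2 + 1)).card < (Finset.univ : Finset (Fin n → Fin H)).card := by
    rw [Finset.card_range, Finset.card_univ, Fintype.card_fun, Fintype.card_fin, Fintype.card_fin]
    have : 3 ≤ H ^ n := hH.trans (Nat.le_self_pow (by omega) H)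
    omega
  obtain ⟨c, -, c', -, hne, heq⟩ := Finset.exists_ne_map_eq_of_card_lt_of_maps_to hcard
    (f := fun c => ⌊(v c + W) / w⌋₊) (fun c _ => by
      rw [Finset.mem_coe, Finset.mem_range, Nat.lt_succ_iff]
      have h1 : (v c + W) / w ≤ ((H ^ n : ℕ) : ℝ) / (2 : ℕ) := by
        rw [div_le_iff₀ hw0, hw]
        have := (abs_le.1 (hv c)).2
        push_cast
        have e : (H : ℝ) ^ n / 2 * (4 * W / (H : ℝ) ^ n) = 2 * W := by
          field_simp
          ring
        rw [e]
        linarith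
      calc ⌊(v c + W) / w⌋₊ ≤ ⌊((H ^ n : ℕ) : ℝ) / (2 : ℕ)⌋₊ := Nat.floor_le_floor h1
        _ = _ := Nat.floor_div_eq_div _ _)
  let d : Fin n → ℤ := fun i => ((c i : ℕ) : ℤ) - ((c' i : ℕ) : ℤ)
  have hd : ∀ i, |d i| ≤ H := fun i => by
    have h1 := (c i).2
    have h2 := (c' i).2
    rw [abs_le]
    constructor <;> simp only [d] <;> omega
  have hQ : ∀ x : ℝ, aeval x (∑ i, C (d i) * X ^ (i : ℕ) : ℤ[X]) =
      ∑ i, (d i : ℝ) * x ^ (i : ℕ) := fun x => by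
    simp [map_sum]
  refine ⟨∑ i, C (d i) * X ^ (i : ℕ), fun h0 => hne (funext fun j => ?_), fun x hx => ?_, ?_⟩
  · have h1 := congrArg (fun q : ℤ[X] => q.coeff (j : ℕ)) h0
    simp only [finsetSum_coeff, coeff_C_mul_X_pow, coeff_zero, Fin.val_inj,
      Finset.sum_ite_eq, Finset.mem_univ, if_true, d] at h1
    exact Fin.ext (by omega)
  · rw [hQ]
    exact abs_sum_mul_pow_le hR hd hx
  · rw [hQ]
    have h1 : ∑ i, (d i : ℝ) * α ^ (i : ℕ) = v c - v c' := by
      simp only [v, ← Finset.sum_sub_distrib, d]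
      refine Finset.sum_congr rfl fun i _ => ?_
      push_cast
      ring
    have hnn : ∀ c, 0 ≤ (v c + W) / w := fun c =>
      div_nonneg (by linarith [(abs_le.1 (hv c)).1]) hw0.le
    have h2 := Nat.floor_le (hnn c)
    have h3 := Nat.lt_floor_add_one ((v c + W) / w)
    have h4 := Nat.floor_le (hnn c')
    have h5 := Nat.lt_floor_add_one ((v c' + W) / w)
    rw [heq] at h2 h3
    have h6 : |(v c + W) / w - (v c' + W) / w| ≤ 1 := by
      rw [abs_le]
      constructor <;> linarith
    rw [h1]
    have e : v c - v c' = ((v c + W) / w - (v c' + W) / w) * w := by field_simp; ring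
    rw [e, abs_mul, abs_of_pos hw0]
    nlinarith

/-- A measure whose logarithmic integrals of integer polynomials are nonnegative has no atoms. -/
theorem measure_singleton_eq_zero_of_integral_log_nonneg {μ : Measure ℝ} [IsProbabilityMeasure μ]
    {S : Set ℝ} (hSc : IsCompact S) (hμ : μ Sᶜ = 0)
    (H : ∀ Q : ℤ[X], Q ≠ 0 → (∀ᵐ x ∂μ, aeval x Q ≠ 0) ∧
      Integrable (fun x => Real.log |aeval x Q|) μ ∧ 0 ≤ ∫ x, Real.log |aeval x Q| ∂μ) (α : ℝ) :
    μ {α} = 0 := by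
  by_contra hα0
  have hSae : ∀ᵐ x ∂μ, x ∈ S := by rwa [ae_iff]
  obtain ⟨R, hR1, hR⟩ : ∃ R : ℝ, 1 ≤ R ∧ ∀ x ∈ S, |x| ≤ R := by
    obtain ⟨R, hR⟩ := hSc.isBounded.exists_norm_le
    exact ⟨max R 1, le_max_right _ _, fun x hx => (hR x hx).trans (le_max_left _ _)⟩
  have hαS : α ∈ S := by
    by_contra h
    exact hα0 (measure_mono_null (Set.singleton_subset_iff.2 h) hμ)
  set m := μ.real {α} with hm
  have hm0 : 0 < m := lt_of_le_of_ne measureReal_nonneg fun h =>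
    hα0 ((measureReal_eq_zero_iff).1 h.symm)
  have hm1 : m ≤ 1 := measureReal_le_one
  -- Off the atom, `log |Q| ≤ log (N A)`; the atom contributes a further `m (log 4 - n log N) ≤ log
  -- 4 - 2 log N`. The total is at most `log (4 A) - log N`, negative once the height `N` exceeds `4
  -- A`.
  obtain ⟨n, hn⟩ := exists_nat_gt (2 / m)
  have hn' : 2 ≤ m * n := by
    rw [div_lt_iff₀ hm0] at hn
    linarith
  have hn1 : 1 ≤ n := by
    rcases Nat.eq_zero_or_pos n with rfl | h
    · norm_num at hn'
    · exact h
  have hn1' : (1 : ℝ) ≤ n := by exact_mod_cast hn1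
  set A : ℝ := n * R ^ n with hA
  have hA1 : 1 ≤ A := one_le_mul_of_one_le_of_one_le hn1' (one_le_pow₀ hR1)
  obtain ⟨N, hN⟩ := exists_nat_gt (4 * A)
  have hN4 : (4 : ℝ) < N := by linarith
  have hN3 : 3 ≤ N := by
    have : 4 < N := by exact_mod_cast hN4
    omega
  have hN0 : (0 : ℝ) < N := by linarith
  obtain ⟨Q, hQ0, hQb, hQα⟩ := exists_int_poly_small hn1 hN3 hR1 (hR α hαS)
  obtain ⟨hne, hint, hpos⟩ := H Q hQ0
  set w : ℝ := 4 * (N * A) / (N : ℝ) ^ n with hw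
  set B := Real.log (N * A) with hB
  have hbound : ∀ᵐ x ∂μ, Real.log |aeval x Q| ≤
      B + ({α} : Set ℝ).indicator (fun _ => Real.log w - B) x := by
    filter_upwards [hne, hSae] with x hx hxS
    have hx0 := abs_pos.2 hx
    by_cases hxα : x = α
    · subst hxα
      rw [Set.indicator_of_mem (Set.mem_singleton _), add_sub_cancel]
      exact Real.log_le_log hx0 hQα
    · rw [Set.indicator_of_notMem (by simpa using hxα), add_zero]
      exact Real.log_le_log hx0 (hQb x (hR x hxS))
  have hi : Integrable (({α} : Set ℝ).indicator fun _ => Real.log w - B) μ :=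
    (integrable_const _).indicator (measurableSet_singleton α)
  have h1 := integral_mono_ae hint ((integrable_const B).add hi) hbound
  rw [integral_add' (integrable_const B) hi, integral_indicator_const _ (measurableSet_singleton α),
    integral_const, probReal_univ, one_smul, smul_eq_mul, ← hm] at h1
  have hlogw : Real.log w = Real.log 4 + B - n * Real.log N := by
    rw [hw, Real.log_div (by positivity) (by positivity), Real.log_mul (by norm_num) (by positivity),
      Real.log_pow]
  have hlogN : Real.log (4 * A) < Real.log N := Real.log_lt_log (by positivity) hN
  rw [Real.log_mul (by norm_num) (by positivity)] at hlogN
  have hBN : B = Real.log N + Real.log A := Real.log_mul hN0.ne' (by positivity)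
  have hl4 : 0 ≤ Real.log 4 := Real.log_nonneg (by norm_num)
  have hlN : 0 ≤ Real.log N := Real.log_nonneg (by linarith)
  rw [hlogw] at h1
  have h2 : m * Real.log 4 ≤ Real.log 4 := by nlinarith
  have h3 : 2 * Real.log N ≤ m * n * Real.log N := mul_le_mul_of_nonneg_right hn' hlN
  nlinarith

/-! ### Small sets for `μ` and smoothing on a grid -/

/-- A measure without atoms has uniformly small mass on short intervals. -/
theorem exists_measureReal_Icc_le {μ : Measure ℝ} [IsProbabilityMeasure μ]
    (hμ : ∀ x, μ {x} = 0) {ε : ℝ} (hε : 0 < ε) :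
    ∃ r : ℝ, 0 < r ∧ ∀ c : ℝ, μ.real (Set.Icc (c - r) (c + r)) ≤ ε := by
  -- The strips `T n` decrease to the diagonal, which is null for `μ × μ`. A square `I × I` over a
  -- short interval lies in a strip, so `μ(I)²` is small uniformly in the centre.
  let T : ℕ → Set (ℝ × ℝ) := fun n => {p | |p.1 - p.2| ≤ 1 / ((n : ℝ) + 1)}
  have hTm : ∀ n, MeasurableSet (T n) := fun n =>
    measurableSet_le (continuous_fst.sub continuous_snd).abs.measurable measurable_const
  have hanti : Antitone T := by
    intro m n hmn p hp
    have h1 : (m : ℝ) ≤ n := by exact_mod_cast hmn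
    have h2 : (1 : ℝ) / ((n : ℝ) + 1) ≤ 1 / ((m : ℝ) + 1) :=
      one_div_le_one_div_of_le (by positivity) (by linarith)
    exact le_trans hp h2
  have hInter : ⋂ n, T n = {p : ℝ × ℝ | p.1 = p.2} := by
    ext p
    simp only [Set.mem_iInter, Set.mem_ofPred_eq, T]
    constructor
    · intro h
      have := ge_of_tendsto' tendsto_one_div_add_atTop_nhds_zero_nat h
      exact sub_eq_zero.1 (abs_eq_zero.1 (le_antisymm this (abs_nonneg _)))
    · intro h n
      rw [h, sub_self, abs_zero]
      positivity
  have hdiag : (μ.prod μ) (⋂ n, T n) = 0 := by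
    rw [Measure.measure_prod_null (MeasurableSet.iInter hTm)]
    refine Eventually.of_forall fun x => ?_
    refine measure_mono_null (t := {x}) (fun y hy => ?_) (hμ x)
    rw [hInter] at hy
    exact hy.symm
  have hlim := tendsto_measure_iInter_atTop (μ := μ.prod μ)
    (fun n => (hTm n).nullMeasurableSet) hanti ⟨0, measure_ne_top _ _⟩
  rw [hdiag] at hlim
  obtain ⟨n, hn⟩ := (hlim.eventually (gt_mem_nhds
    (show (0 : ENNReal) < ENNReal.ofReal (ε ^ 2) by positivity))).exists
  refine ⟨1 / ((n : ℝ) + 1) / 2, by positivity, fun c => ?_⟩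
  set I := Set.Icc (c - 1 / ((n : ℝ) + 1) / 2) (c + 1 / ((n : ℝ) + 1) / 2) with hI
  have hsub : I ×ˢ I ⊆ T n := by
    rintro ⟨x, y⟩ ⟨hx, hy⟩
    simp only [T, Set.mem_ofPred_eq, abs_le]
    constructor <;> linarith [hx.1, hx.2, hy.1, hy.2]
  have h1 : (μ.prod μ).real (I ×ˢ I) ≤ ε ^ 2 :=
    ENNReal.toReal_le_of_le_ofReal (by positivity) ((measure_mono hsub).trans hn.le)
  rw [measureReal_prod_prod, ← sq] at h1
  exact (sq_le_sq₀ measureReal_nonneg hε.le).1 h1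

/-- The points whose grid cell has index outside `F`. -/
def gridCompl (F : Set ℤ) (h : ℝ) : Set ℝ := {x | ⌊x / h⌋ ∉ F}

theorem measurableSet_gridCompl (F : Set ℤ) (h : ℝ) : MeasurableSet (gridCompl F h) :=
  (Int.measurable_floor.comp (measurable_id.div_const h)) (MeasurableSet.of_discrete (s := Fᶜ))

theorem tendsto_measureReal_gridCompl {S : Set ℝ} (hcount : (S \ interior S).Countable)
    {μ : Measure ℝ} [IsProbabilityMeasure μ] (hμ : μ Sᶜ = 0) (hatom : ∀ x, μ {x} = 0) :
    Tendsto (fun h => μ.real (gridCompl (gridIndices S h) h)) (𝓝[>] 0) (𝓝 0) := by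
  have : NullSingletonClass μ := ⟨hatom⟩
  have hSae : ∀ᵐ x ∂μ, x ∈ interior S := by
    rw [ae_iff]
    refine measure_mono_null (t := Sᶜ ∪ (S \ interior S)) ?_
      (measure_union_null hμ (hcount.measure_zero μ))
    intro x hx
    by_cases h : x ∈ S
    · exact Or.inr ⟨h, hx⟩
    · exact Or.inl h
  have h1 : Tendsto (fun h => ∫ x, (gridCompl (gridIndices S h) h).indicator (fun _ => (1 : ℝ)) x ∂μ)
      (𝓝[>] 0) (𝓝 (∫ _, (0 : ℝ) ∂μ)) := by
    refine tendsto_integral_filter_of_dominated_convergence (fun _ => 1)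
      (Eventually.of_forall fun h =>
        (measurable_const.indicator (measurableSet_gridCompl _ h)).aestronglyMeasurable)
      (Eventually.of_forall fun h => Eventually.of_forall fun x => ?_) (integrable_const _) ?_
    · exact (norm_indicator_le_norm_self _ _).trans (by simp)
    · filter_upwards [hSae] with x hx
      refine tendsto_const_nhds.congr' ?_
      filter_upwards [eventually_floor_mem_gridIndices hx] with h hh
      rw [Set.indicator_of_notMem]
      exact fun hn => hn hh
  rw [integral_zero] at h1
  refine h1.congr fun h => ?_
  rw [integral_indicator_const _ (measurableSet_gridCompl _ h), smul_eq_mul, mul_one]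

/-- The function equal to `q k` on the grid cell of index `k ∈ F` and to `q₀` elsewhere. -/
def gridFun (F : Finset ℤ) (h : ℝ) (q : ℤ → ℝ) (q₀ : ℝ) (x : ℝ) : ℝ :=
  if ⌊x / h⌋ ∈ F then q ⌊x / h⌋ else q₀

theorem gridFun_eq {F : Finset ℤ} {h : ℝ} (hh : 0 < h) (q : ℤ → ℝ) (q₀ x : ℝ) :
    gridFun F h q q₀ x = ∑ k ∈ F, (gridCell h k).indicator (fun _ => q k) x +
      (gridCompl F h).indicator (fun _ => q₀) x := by
  classical
  have h1 : ∀ k, (gridCell h k).indicator (fun _ => q k) x = if ⌊x / h⌋ = k then q k else 0 := by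
    intro k
    rw [Set.indicator_apply]
    exact if_congr (mem_gridCell_iff hh) rfl rfl
  simp only [h1]
  rw [Finset.sum_ite_eq, gridFun]
  by_cases hx : ⌊x / h⌋ ∈ F
  · rw [if_pos hx, if_pos hx, Set.indicator_of_notMem (fun hn : ⌊x / h⌋ ∉ F => hn hx), add_zero]
  · rw [if_neg hx, if_neg hx, Set.indicator_of_mem (show x ∈ gridCompl F h from hx), zero_add]

theorem integrable_gridFun {μ : Measure ℝ} [IsProbabilityMeasure μ] (F : Finset ℤ) {h : ℝ}
    (hh : 0 < h) (q : ℤ → ℝ) (q₀ : ℝ) : Integrable (gridFun F h q q₀) μ := by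
  rw [funext (gridFun_eq hh q q₀)]
  exact (integrable_finsetSum _ fun k _ =>
    (integrable_const _).indicator (measurableSet_gridCell h k)).add
      ((integrable_const _).indicator (measurableSet_gridCompl _ h))

theorem integral_gridFun {μ : Measure ℝ} [IsProbabilityMeasure μ] (F : Finset ℤ) {h : ℝ}
    (hh : 0 < h) (q : ℤ → ℝ) (q₀ : ℝ) : ∫ x, gridFun F h q q₀ x ∂μ =
      ∑ k ∈ F, μ.real (gridCell h k) * q k + μ.real (gridCompl F h) * q₀ := by
  have hi : ∀ k ∈ F, Integrable ((gridCell h k).indicator fun _ => q k) μ := fun k _ =>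
    (integrable_const _).indicator (measurableSet_gridCell h k)
  simp only [gridFun_eq hh]
  rw [integral_add (integrable_finsetSum _ hi)
    ((integrable_const _).indicator (measurableSet_gridCompl _ h)), integral_finsetSum _ hi,
    integral_indicator_const _ (measurableSet_gridCompl _ h), smul_eq_mul]
  congr 1
  refine Finset.sum_congr rfl fun k _ => ?_
  rw [integral_indicator_const _ (measurableSet_gridCell h k), smul_eq_mul]

/-- Replace `μ` by uniform measures on the grid cells in `F`, and by `ω` elsewhere; then mix with
`ω` in proportion `ε`. -/
def gridSmoothing (μ ω : Measure ℝ) (F : Finset ℤ) (h ε : ℝ) : Measure ℝ :=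
  mixture (Finset.insertNone F)
    (fun o => o.elim ((1 - ε) * μ.real (gridCompl F h) + ε)
      fun k => (1 - ε) * μ.real (gridCell h k))
    (fun o => o.elim ω fun k => unifMeasure (k * h) h)

section gridSmoothing

variable {μ ω : Measure ℝ} {F : Finset ℤ} {h ε : ℝ}

theorem gridSmoothing_weight_nonneg (hε : 0 ≤ ε) (hε1 : ε ≤ 1) (o : Option ℤ) :
    0 ≤ o.elim ((1 - ε) * μ.real (gridCompl F h) + ε) fun k => (1 - ε) * μ.real (gridCell h k) := by
  have : 0 ≤ 1 - ε := by linarith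
  cases o with
  | none => exact add_nonneg (mul_nonneg this measureReal_nonneg) hε
  | some k => exact mul_nonneg this measureReal_nonneg

theorem isProbabilityMeasure_gridSmoothing [IsProbabilityMeasure μ] [IsProbabilityMeasure ω]
    (hh : 0 < h) (hε : 0 ≤ ε) (hε1 : ε ≤ 1) :
    IsProbabilityMeasure (gridSmoothing μ ω F h ε) := by
  refine isProbabilityMeasure_mixture (fun o _ => gridSmoothing_weight_nonneg hε hε1 o) ?_ ?_
  · have h1 := integral_gridFun (μ := μ) F hh (fun _ => 1) 1
    have h2 : ∫ x, gridFun F h (fun _ => 1) 1 x ∂μ = 1 := by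
      simp [gridFun]
    rw [h2] at h1
    simp only [mul_one] at h1
    rw [Finset.sum_insertNone]
    simp only [Option.elim_none, Option.elim_some, ← Finset.mul_sum]
    linear_combination (-(1 - ε)) * h1
  · rintro (_ | k)
    · assumption
    · exact isProbabilityMeasure_unifMeasure _ hh

theorem hasBoundedDensityOn_gridSmoothing {P : Set ℝ} (hω : HasBoundedDensityOn ω P)
    (hF : ∀ k ∈ F, Set.Icc ((k : ℝ) * h) (k * h + h) ⊆ P) :
    HasBoundedDensityOn (gridSmoothing μ ω F h ε) P := by
  refine hasBoundedDensityOn_mixture ?_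
  rintro (_ | k) hk
  · exact hω
  · exact (hasBoundedDensityOn_unifMeasure _ _).mono (hF k (by simpa using hk))

/-- Writing the smoothed integral as an integral against `μ` itself allows pointwise comparison with
the original integrand. -/
theorem integral_gridSmoothing [IsProbabilityMeasure μ] (hh : 0 < h) (hε : 0 ≤ ε) (hε1 : ε ≤ 1) {f : ℝ → ℝ}
    (hω : Integrable f ω) (hF : ∀ k ∈ F, Integrable f (unifMeasure (k * h) h)) :
    ∫ x, f x ∂(gridSmoothing μ ω F h ε) =
      (1 - ε) * ∫ x, gridFun F h (fun k => ∫ t, f t ∂(unifMeasure (k * h) h)) (∫ t, f t ∂ω) x ∂μ +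
        ε * ∫ t, f t ∂ω := by
  rw [gridSmoothing, integral_mixture (fun o _ => gridSmoothing_weight_nonneg hε hε1 o),
    Finset.sum_insertNone, integral_gridFun F hh]
  · simp only [Option.elim_none, Option.elim_some, mul_assoc, ← Finset.mul_sum]
    ring
  · rintro (_ | k) hk
    · exact hω
    · exact hF k (by simpa using hk)

end gridSmoothing

/-- This bounds, uniformly in `z`, the loss in replacing a point mass by `ω`. For `z` within `4 R`
of `x`, the positive lower bound on the potential suffices; for `z` farther away, all of `P` lies
within `2 R` of `x`, so distances at most halve. -/
theorem exists_log_norm_sub_le_integral_add {S P : Set ℝ} (hSc : IsCompact S) (hPS : P ⊆ S)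
    (hP : IsCompact P) {ω : Measure ℝ} [IsProbabilityMeasure ω] (hω : HasBoundedDensityOn ω P)
    {δ : ℝ} (hδ : 0 < δ) (hV : ∀ z : ℂ, δ ≤ ∫ t, Real.log ‖z - (t : ℂ)‖ ∂ω) :
    ∃ C : ℝ, 0 ≤ C ∧ ∀ x ∈ S, ∀ z : ℂ,
      Real.log ‖z - (x : ℂ)‖ ≤ ∫ t, Real.log ‖z - (t : ℂ)‖ ∂ω + C := by
  obtain ⟨R, hR1, hR⟩ : ∃ R : ℝ, 1 ≤ R ∧ ∀ x ∈ S, |x| ≤ R := by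
    obtain ⟨R, hR⟩ := hSc.isBounded.exists_norm_le
    exact ⟨max R 1, le_max_right _ _, fun x hx => (hR x hx).trans (le_max_left _ _)⟩
  have hC : 0 ≤ Real.log (4 * R) := Real.log_nonneg (by linarith)
  have hl2 : Real.log 2 ≤ Real.log (4 * R) := Real.log_le_log (by norm_num) (by linarith)
  refine ⟨Real.log (4 * R), hC, fun x hx z => ?_⟩
  rcases le_or_gt ‖z - (x : ℂ)‖ (4 * R) with h | h
  · have h1 : Real.log ‖z - (x : ℂ)‖ ≤ Real.log (4 * R) := by
      rcases (norm_nonneg (z - (x : ℂ))).eq_or_lt with h0 | h0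
      · rw [← h0, Real.log_zero]
        exact hC
      · exact Real.log_le_log h0 h
    linarith [hV z]
  · have hpos : 0 < ‖z - (x : ℂ)‖ := by linarith
    have h1 : ∫ _, (Real.log ‖z - (x : ℂ)‖ - Real.log 2) ∂ω ≤
        ∫ t, Real.log ‖z - (t : ℂ)‖ ∂ω := by
      refine integral_mono_ae (integrable_const _) (hω.integrable_log_norm_sub hP z) ?_
      filter_upwards [hω.ae_mem hP.measurableSet] with t ht
      rw [← Real.log_div hpos.ne' (by norm_num)]
      refine Real.log_le_log (by positivity) ?_
      have h2 : ‖z - (x : ℂ)‖ ≤ ‖z - t‖ + ‖(t : ℂ) - x‖ := norm_sub_le_norm_sub_add_norm_sub _ _ _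
      have h3 : ‖(t : ℂ) - x‖ ≤ 2 * R := by
        rw [norm_ofReal_sub_ofReal]
        have := abs_sub t x
        linarith [hR t (hPS ht), hR x hx]
      linarith
    rw [integral_const, probReal_univ, one_smul] at h1
    linarith

theorem log_abs_aeval_eq {Q : ℤ[X]} {n : ℕ} {α : Fin n → ℂ} {c : ℝ} (hc : 1 ≤ c)
    (hQ : ∀ x : ℝ, |aeval x Q| = c * ∏ i, ‖α i - (x : ℂ)‖) {x : ℝ} (hx : ∀ i, α i ≠ x) :
    Real.log |aeval x Q| = Real.log c + ∑ i, Real.log ‖α i - (x : ℂ)‖ := by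
  have h1 : ∀ i ∈ Finset.univ, ‖α i - (x : ℂ)‖ ≠ 0 := fun i _ =>
    norm_ne_zero_iff.2 (sub_ne_zero.2 (hx i))
  rw [hQ, Real.log_mul (by positivity) (Finset.prod_ne_zero_iff.2 h1), Real.log_prod h1]

theorem HasBoundedDensityOn.integral_log_abs_aeval {μ : Measure ℝ} [IsProbabilityMeasure μ]
    {P : Set ℝ} (hμ : HasBoundedDensityOn μ P) (hP : IsCompact P) {Q : ℤ[X]} {n : ℕ}
    {α : Fin n → ℂ} {c : ℝ} (hc : 1 ≤ c)
    (hQ : ∀ x : ℝ, |aeval x Q| = c * ∏ i, ‖α i - (x : ℂ)‖) :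
    (∀ᵐ x ∂μ, aeval x Q ≠ 0) ∧ Integrable (fun x => Real.log |aeval x Q|) μ ∧
      ∫ x, Real.log |aeval x Q| ∂μ = Real.log c + ∑ i, ∫ x, Real.log ‖α i - (x : ℂ)‖ ∂μ := by
  have hne : ∀ᵐ x : ℝ ∂μ, ∀ i, α i ≠ (x : ℂ) :=
    ae_all_iff.2 fun i => hμ.ae_of_ae ((ae_ofReal_ne (α i)).mono fun x hx => hx.symm)
  have heq : (fun x : ℝ => Real.log c + ∑ i, Real.log ‖α i - (x : ℂ)‖) =ᵐ[μ]
      fun x => Real.log |aeval x Q| := hne.mono fun x hx => (log_abs_aeval_eq hc hQ hx).symm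
  have hi : ∀ i ∈ Finset.univ, Integrable (fun x : ℝ => Real.log ‖α i - (x : ℂ)‖) μ :=
    fun i _ => hμ.integrable_log_norm_sub hP (α i)
  refine ⟨hne.mono fun x hx h0 => ?_,
    ((integrable_const _).add (integrable_finsetSum _ hi)).congr heq, ?_⟩
  · have h1 := hQ x
    rw [h0, abs_zero, eq_comm, mul_eq_zero, Finset.prod_eq_zero_iff] at h1
    rcases h1 with h1 | ⟨i, -, h1⟩
    · linarith
    · exact hx i (sub_eq_zero.1 (norm_eq_zero.1 h1))
  · rw [← integral_congr_ae heq, integral_add (integrable_const _) (integrable_finsetSum _ hi),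
      integral_finsetSum _ hi, integral_const, probReal_univ, one_smul]

/-- Smoothing on a grid and mixing with `ω` preserves nonnegativity of the logarithmic integrals,
provided the mass of short intervals and of the complement of the grid is small. -/
theorem integral_log_gridSmoothing_nonneg {S P : Set ℝ} (hP : IsCompact P)
    {μ ω : Measure ℝ} [IsProbabilityMeasure μ] [IsProbabilityMeasure ω] (hμ : μ Sᶜ = 0)
    (hω : HasBoundedDensityOn ω P) {δ : ℝ} (hδ : 0 < δ)
    (hV : ∀ z : ℂ, δ ≤ ∫ t, Real.log ‖z - (t : ℂ)‖ ∂ω)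
    {C : ℝ} (hC : 0 ≤ C) (hVC : ∀ x ∈ S, ∀ z : ℂ,
      Real.log ‖z - (x : ℂ)‖ ≤ ∫ t, Real.log ‖z - (t : ℂ)‖ ∂ω + C)
    {F : Finset ℤ} {h ε K : ℝ} (hh : 0 < h) (hε : 0 < ε) (hε1 : ε ≤ 1) (hK : 2 ≤ K)
    {e₁ e₂ : ℝ} (hball : ∀ c : ℝ, μ.real (Set.Icc (c - K * h) (c + K * h)) ≤ e₁)
    (hcompl : μ.real (gridCompl F h) ≤ e₂)
    (hsmall : 2 / K + (Real.log K + 2) * e₁ + C * e₂ ≤ ε * δ)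
    {Q : ℤ[X]} (hQ : Q ≠ 0) (hne : ∀ᵐ x ∂μ, aeval x Q ≠ 0)
    (hint : Integrable (fun x => Real.log |aeval x Q|) μ)
    (hpos : 0 ≤ ∫ x, Real.log |aeval x Q| ∂μ) :
    0 ≤ ∫ x, Real.log |aeval x Q| ∂(gridSmoothing μ ω F h ε) := by
  obtain ⟨n, α, c, hc, hfac⟩ := exists_abs_aeval_eq_mul_prod hQ
  have hSae : ∀ᵐ x ∂μ, x ∈ S := by rwa [ae_iff]
  have hlogc : 0 ≤ Real.log c := Real.log_nonneg hc
  have hlogK : 0 ≤ Real.log K := Real.log_nonneg (by linarith)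
  obtain ⟨-, hωi, hωv⟩ := hω.integral_log_abs_aeval hP hc hfac
  have hunif : ∀ k : ℤ, Integrable (fun x => Real.log |aeval x Q|) (unifMeasure (k * h) h) ∧
      ∫ x, Real.log |aeval x Q| ∂(unifMeasure (k * h) h) =
        Real.log c + ∑ i, logAvg (k * h) h (α i) := by
    intro k
    have := isProbabilityMeasure_unifMeasure (k * h) hh
    obtain ⟨-, h1, h2⟩ := (hasBoundedDensityOn_unifMeasure (k * h) h).integral_log_abs_aeval
      isCompact_Icc hc hfac
    simp only [integral_log_unifMeasure _ hh] at h2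
    exact ⟨h1, h2⟩
  rw [integral_gridSmoothing hh hε.le hε1 hωi fun k _ => (hunif k).1]
  set q : ℤ → ℝ := fun k => ∫ x, Real.log |aeval x Q| ∂(unifMeasure (k * h) h) with hq
  set q₀ := ∫ x, Real.log |aeval x Q| ∂ω with hq₀
  have hq₀n : n * δ ≤ q₀ := by
    rw [hωv]
    have : ∑ _i : Fin n, δ ≤ ∑ i, ∫ x, Real.log ‖α i - (x : ℂ)‖ ∂ω :=
      Finset.sum_le_sum fun i _ => hV (α i)
    rw [Finset.sum_const, Finset.card_univ, Fintype.card_fin, nsmul_eq_mul] at this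
    linarith
  let J : Fin n → Set ℝ := fun i => Set.Icc ((α i).re - K * h) ((α i).re + K * h)
  -- The loss for one root: `2 / K` always, `log K + 2` when `x` may be within `K h` of the root,
  -- and `C` when the mass at `x` is moved to `ω`. The integrals of the three terms match those of
  -- `hsmall`.
  let err : Fin n → ℝ → ℝ := fun i x => 2 / K + (J i).indicator (fun _ => Real.log K + 2) x +
    (gridCompl F h).indicator (fun _ => C) x
  have hJi : ∀ i, Integrable ((J i).indicator fun _ => Real.log K + 2) μ := fun i =>
    (integrable_const _).indicator measurableSet_Icc
  have hCi : Integrable ((gridCompl F h).indicator fun _ => C) μ :=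
    (integrable_const _).indicator (measurableSet_gridCompl _ h)
  have herri : ∀ i, Integrable (err i) μ := fun i =>
    ((integrable_const (2 / K)).add (hJi i)).add hCi
  have herr : ∀ i, ∫ x, err i x ∂μ ≤ ε * δ := by
    intro i
    have hKJ : Integrable (fun x => 2 / K + (J i).indicator (fun _ => Real.log K + 2) x) μ :=
      (integrable_const (2 / K)).add (hJi i)
    have e : ∫ x, err i x ∂μ =
        2 / K + μ.real (J i) * (Real.log K + 2) + μ.real (gridCompl F h) * C := by
      simp only [err]
      rw [integral_add hKJ hCi,
        integral_add (integrable_const (2 / K)) (hJi i), integral_const, probReal_univ, one_smul,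
        integral_indicator_const _ measurableSet_Icc,
        integral_indicator_const _ (measurableSet_gridCompl _ h), smul_eq_mul, smul_eq_mul]
    rw [e]
    have h1 : μ.real (J i) * (Real.log K + 2) ≤ e₁ * (Real.log K + 2) :=
      mul_le_mul_of_nonneg_right (hball _) (by linarith)
    have h2 : μ.real (gridCompl F h) * C ≤ e₂ * C := mul_le_mul_of_nonneg_right hcompl hC
    linarith
  have hpt : ∀ᵐ x ∂μ, Real.log |aeval x Q| ≤ gridFun F h q q₀ x + ∑ i, err i x := by
    filter_upwards [hne, hSae] with x hx hxS
    have hroot : ∀ i, α i ≠ x := by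
      intro i hi
      refine hx (abs_eq_zero.1 ?_)
      rw [hfac, Finset.prod_eq_zero (Finset.mem_univ i) (by rw [hi, sub_self, norm_zero]), mul_zero]
    rw [log_abs_aeval_eq hc hfac hroot]
    have hK2 : 0 ≤ 2 / K := by positivity
    have hJ0 : ∀ i, 0 ≤ (J i).indicator (fun _ => Real.log K + 2) x := fun i =>
      Set.indicator_nonneg (fun _ _ => by linarith) _
    by_cases hxF : ⌊x / h⌋ ∈ F
    · rw [gridFun, if_pos hxF]
      simp only [hq, (hunif _).2]
      rw [add_assoc, ← Finset.sum_add_distrib]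
      gcongr with i
      have hxc := gridCell_subset_Icc _ _ ((mem_gridCell_iff hh).2 (rfl : ⌊x / h⌋ = ⌊x / h⌋))
      refine (log_norm_sub_le_logAvg_add hh hK hxc (hroot i)).trans ?_
      have h3 : (if ‖α i - (x : ℂ)‖ < K * h then Real.log K + 2 else 0) ≤
          (J i).indicator (fun _ => Real.log K + 2) x := by
        split_ifs with hn
        · have h4 : |(α i).re - x| < K * h := by
            have := Complex.abs_re_le_norm (α i - x)
            simp only [Complex.sub_re, Complex.ofReal_re] at this
            linarith
          rw [abs_lt] at h4
          rw [Set.indicator_of_mem]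
          constructor <;> linarith
        · exact hJ0 i
      have h5 : 0 ≤ (gridCompl F h).indicator (fun _ => C) x :=
        Set.indicator_nonneg (fun _ _ => hC) _
      simp only [err]
      linarith
    · rw [gridFun, if_neg hxF, hωv, add_assoc, ← Finset.sum_add_distrib]
      gcongr with i
      have h5 : (gridCompl F h).indicator (fun _ => C) x = C := Set.indicator_of_mem hxF _
      simp only [err]
      rw [h5]
      linarith [hVC x hxS (α i), hJ0 i]
  have hsi : Integrable (fun x => ∑ i, err i x) μ := integrable_finsetSum _ fun i _ => herri i
  have h1 := integral_mono_ae hint ((integrable_gridFun F hh q q₀).add hsi) hpt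
  rw [integral_add' (integrable_gridFun F hh q q₀) hsi,
    integral_finsetSum _ fun i _ => herri i] at h1
  have h2 : ∑ i, ∫ x, err i x ∂μ ≤ n * (ε * δ) := by
    refine (Finset.sum_le_sum fun i _ => herr i).trans ?_
    rw [Finset.sum_const, Finset.card_univ, Fintype.card_fin, nsmul_eq_mul]
  have h3 : -(n * (ε * δ)) ≤ ∫ x, gridFun F h q q₀ x ∂μ := by linarith
  have h4 : 0 ≤ (n : ℝ) * (ε * δ) := by positivity
  -- Smoothing loses at most `(1 - ε) n ε δ` and mixing with `ω` gains at least `ε n δ`, which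
  -- leaves `ε² n δ ≥ 0`.
  have h5 := mul_le_mul_of_nonneg_left h3 (show 0 ≤ 1 - ε by linarith)
  have h6 := mul_le_mul_of_nonneg_left hq₀n hε.le
  nlinarith

/-- Smoothing on a fine grid changes the integral of a continuous function by little. -/
theorem abs_integral_gridSmoothing_sub_le {S P : Set ℝ} (hSc : IsCompact S) (hPS : P ⊆ S)
    (hP : IsCompact P) {μ ω : Measure ℝ} [IsProbabilityMeasure μ] [IsProbabilityMeasure ω]
    (hμ : μ Sᶜ = 0) (hω : HasBoundedDensityOn ω P) {F : Finset ℤ} {h ε η : ℝ} (hh : 0 < h)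
    (hhη : h ≤ η) (hε : 0 ≤ ε) (hε1 : ε ≤ 1) (hF : ∀ k ∈ F, k ∈ gridIndices S h)
    (hcompl : μ.real (gridCompl F h) ≤ ε) {f : ℝ → ℝ} (hf : ContinuousOn f S) {M r : ℝ}
    (hr : 0 ≤ r) (hM : ∀ x ∈ S, |f x| ≤ M)
    (hmod : ∀ x ∈ S, ∀ y ∈ S, |x - y| ≤ η → |f x - f y| ≤ r) :
    |∫ x, f x ∂(gridSmoothing μ ω F h ε) - ∫ x, f x ∂μ| ≤ r + 4 * M * ε := by
  have hSae : ∀ᵐ x ∂μ, x ∈ S := by rwa [ae_iff]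
  have hM0 : 0 ≤ M := by
    obtain ⟨x, hx⟩ := hSae.exists
    exact (abs_nonneg _).trans (hM x hx)
  have hωi : Integrable f ω := hω.integrable ((hf.mono hPS).integrableOn_compact hP)
  have hui : ∀ k ∈ F, Integrable f (unifMeasure (k * h) h) := fun k hk =>
    (hasBoundedDensityOn_unifMeasure _ _).integrable
      ((hf.mono (hF k hk)).integrableOn_compact isCompact_Icc)
  have hμi : Integrable f μ := by
    have : IntegrableOn f S μ := hf.integrableOn_compact hSc
    rwa [IntegrableOn, Measure.restrict_eq_self_of_ae_mem hSae] at this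
  rw [integral_gridSmoothing hh hε hε1 hωi hui]
  set q : ℤ → ℝ := fun k => ∫ x, f x ∂(unifMeasure (k * h) h) with hq
  set q₀ := ∫ x, f x ∂ω with hq₀
  have hq₀M : |q₀| ≤ M := by
    have := norm_integral_le_of_norm_le_const (μ := ω) (f := f) (C := M)
      ((hω.ae_mem hP.measurableSet).mono fun x hx => hM x (hPS hx))
    rwa [probReal_univ, mul_one] at this
  have hμM : |∫ x, f x ∂μ| ≤ M := by
    have := norm_integral_le_of_norm_le_const (μ := μ) (f := f) (C := M)
      (hSae.mono fun x hx => hM x hx)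
    rwa [probReal_univ, mul_one] at this
  have hgi := integrable_gridFun (μ := μ) F hh q q₀
  have hbi : Integrable ((gridCompl F h).indicator fun _ => 2 * M) μ :=
    (integrable_const _).indicator (measurableSet_gridCompl _ h)
  have hpt : ∀ᵐ x ∂μ, ‖gridFun F h q q₀ x - f x‖ ≤
      r + (gridCompl F h).indicator (fun _ => 2 * M) x := by
    filter_upwards [hSae] with x hx
    rw [Real.norm_eq_abs]
    by_cases hxF : ⌊x / h⌋ ∈ F
    · have hn : (gridCompl F h).indicator (fun _ => 2 * M) x = 0 :=
        Set.indicator_of_notMem (fun hn : ⌊x / h⌋ ∉ F => hn hxF) _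
      rw [gridFun, if_pos hxF, hn, add_zero]
      have hxc := gridCell_subset_Icc _ _ ((mem_gridCell_iff hh).2 (rfl : ⌊x / h⌋ = ⌊x / h⌋))
      have := isProbabilityMeasure_unifMeasure (⌊x / h⌋ * h) hh
      have e : q ⌊x / h⌋ - f x = ∫ t, (f t - f x) ∂(unifMeasure (⌊x / h⌋ * h) h) := by
        rw [integral_sub (hui _ hxF) (integrable_const _), integral_const, probReal_univ, one_smul]
      rw [e]
      have h1 := norm_integral_le_of_norm_le_const (μ := unifMeasure (⌊x / h⌋ * h) h)
        (f := fun t => f t - f x) (C := r)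
        (((hasBoundedDensityOn_unifMeasure (⌊x / h⌋ * h) h).ae_mem measurableSet_Icc).mono
          fun t ht => hmod t (hF _ hxF ht) x hx (by
            rw [abs_le]
            constructor <;> linarith [ht.1, ht.2, hxc.1, hxc.2]))
      rwa [probReal_univ, mul_one] at h1
    · have hn : (gridCompl F h).indicator (fun _ => 2 * M) x = 2 * M :=
        Set.indicator_of_mem hxF _
      rw [gridFun, if_neg hxF, hn]
      have := abs_sub q₀ (f x)
      linarith [hM x hx]
  have h1 : |∫ x, gridFun F h q q₀ x ∂μ - ∫ x, f x ∂μ| ≤ r + 2 * M * ε := by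
    rw [← integral_sub hgi hμi]
    have h2 := norm_integral_le_of_norm_le ((integrable_const r).add hbi) hpt
    rw [integral_add' (integrable_const r) hbi,
      integral_indicator_const _ (measurableSet_gridCompl _ h), integral_const, probReal_univ,
      one_smul, smul_eq_mul] at h2
    rw [← Real.norm_eq_abs]
    have h3 : μ.real (gridCompl F h) * (2 * M) ≤ ε * (2 * M) :=
      mul_le_mul_of_nonneg_right hcompl (by linarith)
    linarith
  -- The `4 M ε` splits evenly: `2 M ε` from the mass outside the grid, and `2 M ε` from mixing with
  -- `ω`.
  have h2 : (1 - ε) * ∫ x, gridFun F h q q₀ x ∂μ + ε * q₀ - ∫ x, f x ∂μ =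
      (1 - ε) * (∫ x, gridFun F h q q₀ x ∂μ - ∫ x, f x ∂μ) + ε * (q₀ - ∫ x, f x ∂μ) := by ring
  rw [h2]
  refine (abs_add_le _ _).trans ?_
  rw [abs_mul, abs_mul, abs_of_nonneg hε, abs_of_nonneg (show 0 ≤ 1 - ε by linarith)]
  have h3 : (1 - ε) * |∫ x, gridFun F h q q₀ x ∂μ - ∫ x, f x ∂μ| ≤ 1 * (r + 2 * M * ε) :=
    mul_le_mul (by linarith) h1 (abs_nonneg _) zero_le_one
  have h4 : ε * |q₀ - ∫ x, f x ∂μ| ≤ ε * (2 * M) := by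
    refine mul_le_mul_of_nonneg_left ?_ hε
    have := abs_sub q₀ (∫ x, f x ∂μ)
    linarith
  linarith

/-! ### Approximation at a given scale and conclusion -/

/-- Approximation, at every scale `η`, by a measure of bounded density on a finite union of
intervals. -/
theorem exists_boundedDensity_approx {S : Set ℝ} (hSc : IsCompact S)
    (hcount : (S \ interior S).Countable) (hcap : 1 < logCapacity S) {μ : Measure ℝ}
    [IsProbabilityMeasure μ] (hμ : μ Sᶜ = 0)
    (H : ∀ Q : ℤ[X], Q ≠ 0 → (∀ᵐ x ∂μ, aeval x Q ≠ 0) ∧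
      Integrable (fun x => Real.log |aeval x Q|) μ ∧ 0 ≤ ∫ x, Real.log |aeval x Q| ∂μ)
    {η : ℝ} (hη : 0 < η) (hη1 : η ≤ 1) :
    ∃ (m : Measure ℝ) (T : Set ℝ), IsProbabilityMeasure m ∧ IsFiniteIntervalUnion T ∧ T ⊆ S ∧
      HasBoundedDensityOn m T ∧
      (∀ Q : ℤ[X], Q ≠ 0 → 0 ≤ ∫ x, Real.log |aeval x Q| ∂m) ∧
      ∀ (f : ℝ → ℝ) (M r : ℝ), ContinuousOn f S → 0 ≤ r → (∀ x ∈ S, |f x| ≤ M) →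
        (∀ x ∈ S, ∀ y ∈ S, |x - y| ≤ η → |f x - f y| ≤ r) →
        |∫ x, f x ∂m - ∫ x, f x ∂μ| ≤ r + 4 * M * η := by
  classical
  obtain ⟨ω, P, δ, _, hPu, hPS, hω, hδ, hV⟩ := exists_boundedDensity_pos hSc hcount hcap
  obtain ⟨C, hC, hVC⟩ := exists_log_norm_sub_le_integral_add hSc hPS hPu.isCompact hω hδ hV
  have hatom := measure_singleton_eq_zero_of_integral_log_nonneg hSc hμ H
  have hθ : 0 < η * δ := mul_pos hη hδ
  -- The budget `η δ` is divided into thirds: `K` handles distant roots, `e₁` the mass near a root,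
  -- and `e₂` the mass outside the grid. The extra bound `e₂ ≤ η` serves the weak* estimate. Only
  -- then is the mesh chosen, with `K h ≤ ρ`.
  set K := max 2 (6 / (η * δ)) with hK
  have hK2 : 2 ≤ K := le_max_left _ _
  have hK0 : 0 < K := by linarith
  have hKθ : 2 / K ≤ η * δ / 3 := by
    have : 6 / (η * δ) ≤ K := le_max_right _ _
    rw [div_le_iff₀ hθ] at this
    rw [div_le_iff₀ hK0]
    linarith
  have hlK : 0 < Real.log K + 2 := by
    have := Real.log_nonneg (show 1 ≤ K by linarith)
    linarith
  set e₁ := η * δ / 3 / (Real.log K + 2) with he₁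
  have he₁0 : 0 < e₁ := by positivity
  obtain ⟨ρ, hρ, hball⟩ := exists_measureReal_Icc_le hatom he₁0
  set e₂ := min η (η * δ / 3 / (C + 1)) with he₂
  have he₂0 : 0 < e₂ := lt_min hη (by positivity)
  have hCe₂ : C * e₂ ≤ η * δ / 3 := by
    have h1 : e₂ ≤ η * δ / 3 / (C + 1) := min_le_right _ _
    rw [le_div_iff₀ (by linarith)] at h1
    nlinarith
  have hKρ : 0 < ρ / K := div_pos hρ hK0
  have hev : ∀ c : ℝ, 0 < c → ∀ᶠ h in 𝓝[>] (0 : ℝ), h < c := fun c hc =>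
    mem_nhdsWithin_of_mem_nhds (Iio_mem_nhds hc)
  obtain ⟨h, hcompl, hhη, hhρ, hh⟩ :=
    (((tendsto_measureReal_gridCompl hcount hμ hatom).eventually (gt_mem_nhds he₂0)).and
      ((hev η hη).and ((hev (ρ / K) hKρ).and self_mem_nhdsWithin))).exists
  have hh : 0 < h := hh
  have hKh : K * h ≤ ρ := by
    rw [lt_div_iff₀ hK0] at hhρ
    linarith
  set F := (finite_gridIndices hSc hh).toFinset with hF
  have hFc : (F : Set ℤ) = gridIndices S h := by simp [hF]
  have hF' : ∀ k ∈ F, k ∈ gridIndices S h := fun k hk => by simpa [hF] using hk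
  have hcompl' : μ.real (gridCompl F h) ≤ e₂ := by
    rw [hFc]
    exact hcompl.le
  have hm := isProbabilityMeasure_gridSmoothing (μ := μ) (ω := ω) (F := F) hh hη.le hη1
  have hT : ∃ T, IsFiniteIntervalUnion T ∧ T ⊆ S ∧ P ⊆ T ∧
      ∀ k ∈ F, Set.Icc ((k : ℝ) * h) (k * h + h) ⊆ T := by
    rcases F.eq_empty_or_nonempty with h0 | h0
    · exact ⟨P, hPu, hPS, le_rfl, by simp [h0]⟩
    · refine ⟨P ∪ ⋃ k ∈ F, Set.Icc ((k : ℝ) * h) (k * h + h),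
        hPu.union (isFiniteIntervalUnion_biUnion h0 (fun k : ℤ => (k : ℝ) * h) hh),
        Set.union_subset hPS (Set.iUnion₂_subset hF'), Set.subset_union_left, fun k hk => ?_⟩
      exact (Set.subset_biUnion_of_mem
        (u := fun k : ℤ => Set.Icc ((k : ℝ) * h) (k * h + h)) hk).trans Set.subset_union_right
  obtain ⟨T, hTu, hTS, hPT, hFT⟩ := hT
  refine ⟨gridSmoothing μ ω F h η, T, hm, hTu, hTS,
    hasBoundedDensityOn_gridSmoothing (hω.mono hPT) hFT, fun Q hQ => ?_, ?_⟩
  · obtain ⟨hne, hint, hpos⟩ := H Q hQ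
    refine integral_log_gridSmoothing_nonneg hPu.isCompact hμ hω hδ hV hC hVC hh hη hη1 hK2
      (fun c => (measureReal_mono (Set.Icc_subset_Icc (by linarith) (by linarith))).trans (hball c))
      hcompl' ?_ hQ hne hint hpos
    have h1 : (Real.log K + 2) * e₁ = η * δ / 3 := by
      rw [he₁]
      field_simp
    linarith
  · intro f M r hf hr hM hmod
    exact abs_integral_gridSmoothing_sub_le hSc hPS hPu.isCompact hμ hω hh hhη.le hη.le hη1 hF'
      (hcompl'.trans (min_le_left _ _)) hf hr hM hmod

end

theorem mainTheorem10 (S : Set ℝ) (hS : IsCompact S) (hcomp : Countable (ConnectedComponents S))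
    (hcap : 1 < logCapacity S)
    (μ : Measure ℝ) (hμ : IsProbabilityMeasure μ) (hsupp : μ.support ⊆ S)
    (hint : ∀ Q : ℤ[X], Q ≠ 0 → 0 ≤ logPolyIntegral μ S Q) :
    ∃ (μs : ℕ → Measure ℝ) (Ss : ℕ → Set ℝ),
      (∀ k, IsProbabilityMeasure (μs k) ∧ IsHolderMeasure (μs k)) ∧
      (∀ k, IsClosed (Ss k) ∧ Ss k ⊆ S) ∧
      (∀ k, IsCompactFiniteUnionOfIntervals (Ss k) ∧ (μs k).support ⊆ Ss k) ∧
      (∀ k, ∀ Q : ℤ[X], Q ≠ 0 → 0 ≤ logPolyIntegral (μs k) (Ss k) Q) ∧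
      WeakStarTendsto S μs μ := by
  have hμS : μ Sᶜ = 0 := measure_compl_eq_zero_of_support_subset hsupp
  have hSae : ∀ᵐ x ∂μ, x ∈ S := by rwa [ae_iff]
  have H : ∀ Q : ℤ[X], Q ≠ 0 → (∀ᵐ x ∂μ, aeval x Q ≠ 0) ∧
      Integrable (fun x => Real.log |aeval x Q|) μ ∧ 0 ≤ ∫ x, Real.log |aeval x Q| ∂μ := by
    intro Q hQ
    have hcont : Continuous fun x : ℝ => aeval x Q := Q.continuous_aeval
    obtain ⟨C, hC⟩ := hS.exists_bound_of_continuousOn hcont.continuousOn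
    exact integrable_of_logPolyIntegral_nonneg hμS hC (hint Q hQ)
  have hη : ∀ k : ℕ, 0 < 1 / ((k : ℝ) + 1) ∧ 1 / ((k : ℝ) + 1) ≤ 1 := fun k =>
    ⟨by positivity, by
      rw [div_le_one (by positivity)]
      linarith [(Nat.cast_nonneg k : (0 : ℝ) ≤ k)]⟩
  -- The approximation at scale `1 / (k + 1)` is chosen before any test function, so one sequence
  -- serves every `f`, whose modulus of continuity enters only afterwards.
  choose μs Ss hprob hfin hsub hbd hnn hclose using fun k : ℕ =>
    exists_boundedDensity_approx hS (countable_diff_interior hS hcomp) hcap hμS H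
      (hη k).1 (hη k).2
  have hclosed : ∀ k, IsClosed (Ss k) := fun k => (hfin k).isCompact.isClosed
  have hae : ∀ k, ∀ᵐ x ∂(μs k), x ∈ Ss k := fun k => (hbd k).ae_mem (hclosed k).measurableSet
  refine ⟨μs, Ss, fun k => ⟨hprob k, (hbd k).isHolderMeasure⟩, fun k => ⟨hclosed k, hsub k⟩,
    fun k => ⟨(hfin k).isCompactFiniteUnionOfIntervals, (hbd k).support_subset (hclosed k)⟩,
    fun k Q hQ => ?_, fun f hf => ?_⟩
  · obtain ⟨n, α, c, hc, hfac⟩ := exists_abs_aeval_eq_mul_prod hQ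
    have := hprob k
    obtain ⟨hne, hi, -⟩ := (hbd k).integral_log_abs_aeval (hfin k).isCompact hc hfac
    exact logPolyIntegral_nonneg (mem_ae_iff.1 (hae k)) hne hi (hnn k Q hQ)
  · have hrestr : ∀ k, (μs k).restrict S = μs k := fun k =>
      Measure.restrict_eq_self_of_ae_mem ((hae k).mono fun x hx => hsub k hx)
    simp only [hrestr, Measure.restrict_eq_self_of_ae_mem hSae]
    obtain ⟨M, hM⟩ := hS.exists_bound_of_continuousOn hf
    have hM0 : 0 ≤ M := by
      obtain ⟨x, hx⟩ := hSae.exists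
      exact (norm_nonneg _).trans (hM x hx)
    have huc := Metric.uniformContinuousOn_iff.1 (hS.uniformContinuousOn_of_continuous hf)
    rw [Metric.tendsto_atTop]
    intro ε hε
    obtain ⟨ρ, hρ, hmod⟩ := huc (ε / 2) (half_pos hε)
    have hlim : Tendsto (fun k : ℕ => 1 / ((k : ℝ) + 1)) atTop (𝓝 0) :=
      tendsto_one_div_add_atTop_nhds_zero_nat
    have hlim' : Tendsto (fun k : ℕ => 4 * M * (1 / ((k : ℝ) + 1))) atTop (𝓝 0) := by
      simpa using hlim.const_mul (4 * M)
    obtain ⟨N, hN⟩ := eventually_atTop.1 ((hlim.eventually (gt_mem_nhds hρ)).and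
      (hlim'.eventually (gt_mem_nhds (half_pos hε))))
    refine ⟨N, fun k hk => ?_⟩
    obtain ⟨h1, h2⟩ := hN k hk
    rw [Real.dist_eq]
    have := hclose k f M (ε / 2) hf (half_pos hε).le hM fun x hx y hy hxy =>
      (hmod x hx y hy (by rw [Real.dist_eq]; linarith)).le
    linarith
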